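/- Let $m,n\ge 1$, identify $\mathbb T^m$ with the periodic cube $[0,2\pi]^m$, and for a function $f$ on $\mathbb T^m\times\mathbb R^n$ put $$\hat f(k,\xi)=\frac1{(2\pi)^{m+n}}\int_{\mathbb T^m\times\mathbb R^n} f(x,y)e^{-i(k\cdot x+\xi\cdot y)}\,dx\,dy,\qquad k\in\mathbb Z^m,\ \xi\in\mathbb R^n.$$ The Fourier multiplier operator with symbol $M(k,\xi)$ is $f\mapsto\sum_{k\in\mathbb Z^m}\int_{\mathbb R^n}M(k,\xi)\hat f(k,\xi)e^{i(k\cdot x+\xi\cdot y)}\,d\xi$. Let $e^{it\Delta}$ and $(1-\Delta)^{\alpha/2}$ be the operators with symbols $e^{-it(|k|^2+|\xi|^2)}$ and $(1+|k|^2+|\xi|^2)^{\alpha/2}$, and let $\|f\|_{W^{\alpha,p}}=\|(1-\Delta)^{\alpha/2}f\|_{L^p(\mathbb T^m\times\mathbb R^n)}$. Let $\sigma_0\in C_c^\infty(\mathbb R^{m+n})$ be non-negative with $\operatorname{supp}\sigma_0\subset[-\frac34,\frac34)^{m+n}$ and $\sum_{K\in\mathbb Z^{m+n}}\sigma_0(\cdot-K)=1$,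 let $\square_K$ be the operator with symbol $\sigma_K=\sigma_0(\cdot-K)$ (restricted to $\mathbb Z^m\times\mathbb R^n$), let $\langle K\rangle=(1+|K|^2)^{1/2}$ and $$\|f\|_{M^\alpha_{p,q}}=\Big(\sum_{K\in\mathbb Z^{m+n}}\langle K\rangle^{q\alpha}\|\square_Kf\|_{L^p(\mathbb T^m\times\mathbb R^n)}^q\Big)^{1/q}$$ (the supremum of $\langle K\rangle^{\alpha}\|\square_Kf\|_{L^p}$ over $K$ if $q=\infty$). The Schwartz class of $\mathbb T^m\times\mathbb R^n$ consists of the smooth functions, $2\pi$-periodic in each $x_i$, all of whose derivatives decay rapidly in $y$. Below $1/\infty=0$. (i) Let $1\le p,q,r\le\infty$ and $\alpha\ge0$, and suppose there is a constant $C$ such that $$\big\|e^{it\Delta}f\big\|_{L^q(\mathbb T^m\times\mathbb R^n,\,L^r_t[0,1])}\le C\|f\|_{W^{\alpha,p}(\mathbb T^m\times\mathbb R^n)}$$ for all Schwartz functions $f$ on $\mathbb T^m\times\mathbb R^n$. Then $$\alpha\ge(m+n)\Big(\frac12-\frac1q\Big)+n\Big(\frac12-\frac1p\Big)-\frac2r.$$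 In particular, if $p=q=r$ then $\alpha\ge(m+2n)(\frac12-\frac1p)-\frac2p$; and if $p=2$ and $q=r$ then $\alpha\ge(m+n)(\frac12-\frac1q)-\frac2q$. (ii) Let $1\le p,q\le\infty$ and $\alpha\in\mathbb R$, and suppose there is a constant $C$ such that $$\big\|e^{it\Delta}f\big\|_{L^p(\mathbb T^m\times\mathbb R^n\times[0,1])}\le C\|f\|_{M^\alpha_{p,q}(\mathbb T^m\times\mathbb R^n)}$$ for all Schwartz functions $f$ on $\mathbb T^m\times\mathbb R^n$. Then $$\alpha\ge\max\Big\{0,\ (m+n)\Big(1-\frac1p-\frac1q\Big)-\frac2p\Big\}.$$ -/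

import Mathlib

open MeasureTheory
open scoped ENNReal NNReal

/-- Coordinates `(x, y)` for `𝕋^m × ℝ^n`. The torus `𝕋^m` is identified with the periodic cube
`[0, 2π]^m`: a function on `𝕋^m × ℝ^n` is a function of `(x, y) ∈ ℝ^m × ℝ^n` that is
`2π`-periodic in every coordinate of `x`. -/
abbrev Cyl (m n : ℕ) : Type := (Fin m → ℝ) × (Fin n → ℝ)

/-- The measure `dx dy` on `[0, 2π]^m × ℝ^n`. -/
noncomputable def cylMeasure (m n : ℕ) : Measure (Cyl m n) :=
  ((volume : Measure (Fin m → ℝ)).restrict (Set.Icc 0 (fun _ => 2 * Real.pi))).prod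
    (volume : Measure (Fin n → ℝ))

/-- Lebesgue measure on the time interval `[0, 1]`. -/
noncomputable def timeMeasure : Measure ℝ := volume.restrict (Set.Icc 0 1)

/-- The Schwartz class of `𝕋^m × ℝ^n`: smooth functions, `2π`-periodic in each `x_i`, all of
whose derivatives decay rapidly in `y`. -/
structure IsCylSchwartz {m n : ℕ} (f : Cyl m n → ℂ) : Prop where
  smooth : ContDiff ℝ ((⊤ : ℕ∞) : WithTop ℕ∞) f
  periodic : ∀ (k : Fin m → ℤ) (x : Fin m → ℝ) (y : Fin n → ℝ),
    f (fun i => x i + 2 * Real.pi * (k i : ℝ), y) = f (x, y)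
  decay : ∀ N j : ℕ, ∃ C : ℝ, ∀ z : Cyl m n, ‖z.2‖ ^ N * ‖iteratedFDeriv ℝ j f z‖ ≤ C

/-- The phase `k · x + ξ · y`. -/
def cylPhase {m n : ℕ} (k : Fin m → ℤ) (ξ : Fin n → ℝ) (z : Cyl m n) : ℝ :=
  (∑ i, (k i : ℝ) * z.1 i) + ∑ j, ξ j * z.2 j

/-- `|k|² + |ξ|²`, with Euclidean norms; this is the symbol of `-Δ`. -/
def freqSq {m n : ℕ} (k : Fin m → ℤ) (ξ : Fin n → ℝ) : ℝ :=
  (∑ i, (k i : ℝ) ^ 2) + ∑ j, ξ j ^ 2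

/-- `f̂(k, ξ) = (2π)^{-(m+n)} ∫ f(x, y) e^{-i(k·x + ξ·y)} dx dy`. -/
noncomputable def cylFourier {m n : ℕ} (f : Cyl m n → ℂ) (k : Fin m → ℤ) (ξ : Fin n → ℝ) : ℂ :=
  (((2 * Real.pi) ^ (m + n) : ℝ) : ℂ)⁻¹ *
    ∫ z, f z * Complex.exp (-(Complex.I * (cylPhase k ξ z : ℂ))) ∂(cylMeasure m n)

/-- The Fourier multiplier operator with symbol `M`:
`∑_{k ∈ ℤ^m} ∫_{ℝ^n} M(k, ξ) f̂(k, ξ) e^{i(k·x + ξ·y)} dξ`. -/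
noncomputable def cylMultiplier {m n : ℕ} (M : (Fin m → ℤ) → (Fin n → ℝ) → ℂ)
    (f : Cyl m n → ℂ) (z : Cyl m n) : ℂ :=
  ∑' k : Fin m → ℤ, ∫ ξ : Fin n → ℝ,
    M k ξ * cylFourier f k ξ * Complex.exp (Complex.I * (cylPhase k ξ z : ℂ))

/-- The Schrödinger propagator `e^{itΔ}`. -/
noncomputable def schrodinger {m n : ℕ} (t : ℝ) (f : Cyl m n → ℂ) : Cyl m n → ℂ :=
  cylMultiplier (fun k ξ => Complex.exp (-(Complex.I * (t : ℂ) * (freqSq k ξ : ℂ)))) f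

/-- The Bessel potential `(1 - Δ)^{α/2}`. -/
noncomputable def besselPotential {m n : ℕ} (α : ℝ) (f : Cyl m n → ℂ) : Cyl m n → ℂ :=
  cylMultiplier (fun k ξ => (((1 + freqSq k ξ) ^ (α / 2) : ℝ) : ℂ)) f

/-- `‖f‖_{W^{α,p}} = ‖(1 - Δ)^{α/2} f‖_{L^p}`. -/
noncomputable def sobolevNorm {m n : ℕ} (α : ℝ) (p : ℝ≥0∞) (f : Cyl m n → ℂ) : ℝ≥0∞ :=
  eLpNorm (besselPotential α f) p (cylMeasure m n)

/-- `‖e^{itΔ} f‖_{L^q(𝕋^m × ℝ^n, L^r[0,1])}`: the inner norm is in `t`, the outer one in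
`(x, y)`. -/
noncomputable def mixedNorm {m n : ℕ} (q r : ℝ≥0∞) (f : Cyl m n → ℂ) : ℝ≥0∞ :=
  eLpNorm (fun z : Cyl m n => eLpNorm (fun t : ℝ => schrodinger t f z) r timeMeasure) q
    (cylMeasure m n)

/-- `‖e^{itΔ} f‖_{L^p(𝕋^m × ℝ^n × [0,1])}`. -/
noncomputable def spaceTimeNorm {m n : ℕ} (p : ℝ≥0∞) (f : Cyl m n → ℂ) : ℝ≥0∞ :=
  eLpNorm (fun w : Cyl m n × ℝ => schrodinger w.2 f w.1) p ((cylMeasure m n).prod timeMeasure)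

/-- The translate `σ_K = σ_0(· - K)`, for `K ∈ ℤ^m × ℤ^n`. -/
def latticeTranslate {m n : ℕ} (σ : Cyl m n → ℝ) (K : (Fin m → ℤ) × (Fin n → ℤ))
    (z : Cyl m n) : ℝ :=
  σ (fun i => z.1 i - (K.1 i : ℝ), fun j => z.2 j - (K.2 j : ℝ))

/-- `σ = σ_0` generates a smooth partition of unity `(σ_K)_K` of the frequency space `ℝ^{m+n}`
adapted to the unit cubes `K + [-1/2, 1/2)^{m+n}`, with `supp σ_0 ⊆ [-3/4, 3/4)^{m+n}`. -/
structure IsUnitCubePartition {m n : ℕ} (σ : Cyl m n → ℝ) : Prop where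
  smooth : ContDiff ℝ ((⊤ : ℕ∞) : WithTop ℕ∞) σ
  nonneg : ∀ z, 0 ≤ σ z
  support : tsupport σ ⊆ {z : Cyl m n | (∀ i, z.1 i ∈ Set.Ico (-(3 / 4) : ℝ) (3 / 4)) ∧
    ∀ j, z.2 j ∈ Set.Ico (-(3 / 4) : ℝ) (3 / 4)}
  sum_eq_one : ∀ z, HasSum (fun K => latticeTranslate σ K z) 1

/-- `□_K f`, the Fourier multiplier with symbol `σ_K`. -/
noncomputable def boxOp {m n : ℕ} (σ : Cyl m n → ℝ) (K : (Fin m → ℤ) × (Fin n → ℤ))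
    (f : Cyl m n → ℂ) : Cyl m n → ℂ :=
  cylMultiplier (fun k ξ => (latticeTranslate σ K (fun i => (k i : ℝ), ξ) : ℂ)) f

/-- `⟨K⟩ = (1 + |K|²)^{1/2}`. -/
noncomputable def japanese {m n : ℕ} (K : (Fin m → ℤ) × (Fin n → ℤ)) : ℝ :=
  Real.sqrt (1 + freqSq K.1 (fun j => (K.2 j : ℝ)))

/-- `‖f‖_{M^α_{p,q}}`: the `ℓ^q(ℤ^{m+n})` norm of `K ↦ ⟨K⟩^α ‖□_K f‖_{L^p}`, which is
`(∑_K ⟨K⟩^{qα} ‖□_K f‖_{L^p}^q)^{1/q}` for `q < ∞` and the supremum for `q = ∞`. -/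
noncomputable def modulationNorm {m n : ℕ} (σ : Cyl m n → ℝ) (α : ℝ) (p q : ℝ≥0∞)
    (f : Cyl m n → ℂ) : ℝ≥0∞ :=
  eLpNorm (fun K : (Fin m → ℤ) × (Fin n → ℤ) =>
    ENNReal.ofReal (japanese K ^ α) * eLpNorm (boxOp σ K f) p (cylMeasure m n)) q Measure.count

open Filter
open Complex (I)
open scoped SchwartzMap FourierTransform ContDiff Matrix

/-! Both necessary conditions come from data whose evolution is large on a small space-time box.

*Part (ii).* The test data have Fourier transform a sum of identical bumps, one at each point of a
finite set of lattice frequencies; each `□_K` then sees at most one of the bumps. A single bump at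
`(L, …, L; 0)` keeps its size during the whole time interval `[0, 1]`, and letting `L → ∞` gives
`α ≥ 0`. With bumps at `{0, …, N - 1}^(m + n)`, all waves are in phase for `|x|, |y| ≲ 1 / N` and
`0 ≤ t ≲ 1 / N²`, which gives the other lower bound as `N → ∞`.

*Part (i).* Prescribe `(1 - Δ)^(α/2) f` to have Fourier transform
`exp (-|ξ|² / N²) exp (i t₀ (|k|² + |ξ|²))` on `k ∈ {0, …, N - 1}^m`, so that all waves are in phase
near the origin at times within `1 / N²` of `t₀`. For `t₀ = π a / N` with `N = 4 a + 1`, the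
function `(1 - Δ)^(α/2) f` factors into `m` quadratic Weyl sums, each at most of order
`√(N log N)`, and a bounded Gaussian of width `N` in `y`. Letting `N → ∞` gives the lower bound for
`α`. -/

/-! ### Plane waves and Schwartz functions on the cylinder -/

/-- The plane wave `x ↦ e^{i a·x}` of frequency `a`. -/
noncomputable def planeWave {ι : Type*} [Fintype ι] (a x : ι → ℝ) : ℂ :=
  Complex.exp (I * ((a ⬝ᵥ x : ℝ) : ℂ))

/-- An integer vector as a real vector. -/
def toRealVec {ι : Type*} (k : ι → ℤ) : ι → ℝ := fun i => k i

section PlaneWave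

variable {ι : Type*} [Fintype ι]

theorem norm_planeWave (a x : ι → ℝ) : ‖planeWave a x‖ = 1 :=
  Complex.norm_exp_I_mul_ofReal _

theorem continuous_planeWave (a : ι → ℝ) : Continuous (planeWave a) := by
  unfold planeWave dotProduct
  fun_prop

theorem planeWave_add (a b x : ι → ℝ) : planeWave (a + b) x = planeWave a x * planeWave b x := by
  simp only [planeWave, add_dotProduct, Complex.ofReal_add, mul_add, Complex.exp_add]

theorem planeWave_eq_prod (a x : ι → ℝ) :
    planeWave a x = ∏ i, Complex.exp (I * ((a i * x i : ℝ) : ℂ)) := by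
  rw [planeWave, dotProduct, Complex.ofReal_sum, Finset.mul_sum, Complex.exp_sum]

theorem planeWave_toRealVec_add_two_pi (k l : ι → ℤ) (x : ι → ℝ) :
    planeWave (toRealVec k) (fun i => x i + 2 * Real.pi * l i) = planeWave (toRealVec k) x := by
  rw [planeWave_eq_prod, planeWave_eq_prod]
  refine Finset.prod_congr rfl fun i _ => Complex.exp_eq_exp_iff_exists_int.mpr ⟨k i * l i, ?_⟩
  push_cast [toRealVec]
  ring

theorem contDiff_cexp_mul_ofReal (c : ℂ) {N : WithTop ℕ∞} :
    ContDiff ℝ N fun s : ℝ => Complex.exp (c * s) :=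
  (contDiff_const.mul Complex.ofRealCLM.contDiff).cexp

theorem norm_iteratedFDeriv_cexp_mul_ofReal (c : ℂ) (j : ℕ) (s : ℝ) :
    ‖iteratedFDeriv ℝ j (fun s : ℝ => Complex.exp (c * s)) s‖ =
      ‖c‖ ^ j * Real.exp (c.re * s) := by
  have hderiv : ∀ j : ℕ, iteratedDeriv j (fun s : ℝ => Complex.exp (c * s)) =
      fun s : ℝ => c ^ j * Complex.exp (c * s) := by
    intro j
    induction j with
    | zero => simp
    | succ j ih =>
      funext s
      have hlin : HasDerivAt (fun s : ℝ => c * (s : ℂ)) (c * 1) s :=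
        (Complex.ofRealCLM.hasDerivAt (x := s)).const_mul c
      rw [iteratedDeriv_succ, ih, (hlin.cexp.const_mul _).deriv]
      ring
  rw [norm_iteratedFDeriv_eq_norm_iteratedDeriv, hderiv, norm_mul, norm_pow, Complex.norm_exp,
    Complex.re_mul_ofReal]

theorem norm_iteratedFDeriv_comp_clm_le {E F G : Type*} [NormedAddCommGroup E] [NormedSpace ℝ E]
    [NormedAddCommGroup F] [NormedSpace ℝ F] [NormedAddCommGroup G] [NormedSpace ℝ G]
    {f : F → G} (hf : ContDiff ℝ ∞ f) (L : E →L[ℝ] F) (j : ℕ) (x : E) :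
    ‖iteratedFDeriv ℝ j (f ∘ L) x‖ ≤ ‖iteratedFDeriv ℝ j f (L x)‖ * ‖L‖ ^ j := by
  rw [L.iteratedFDeriv_comp_right hf x (mod_cast le_top)]
  simpa using ContinuousMultilinearMap.norm_compContinuousLinearMap_le
    (iteratedFDeriv ℝ j f (L x)) fun _ => L

/-- The linear form `x ↦ a · x`. -/
noncomputable def dotForm (a : ι → ℝ) : (ι → ℝ) →L[ℝ] ℝ :=
  ∑ i, a i • ContinuousLinearMap.proj i

theorem planeWave_eq_comp (a : ι → ℝ) :
    planeWave a = (fun s : ℝ => Complex.exp (I * s)) ∘ dotForm a := by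
  funext x
  simp [planeWave, dotForm, dotProduct]

theorem contDiff_planeWave (a : ι → ℝ) : ContDiff ℝ ∞ (planeWave a) := by
  rw [planeWave_eq_comp]
  exact (contDiff_cexp_mul_ofReal I).comp (dotForm a).contDiff

theorem norm_iteratedFDeriv_planeWave_le (a : ι → ℝ) (j : ℕ) (x : ι → ℝ) :
    ‖iteratedFDeriv ℝ j (planeWave a) x‖ ≤ ‖dotForm a‖ ^ j := by
  rw [planeWave_eq_comp]
  refine (norm_iteratedFDeriv_comp_clm_le (contDiff_cexp_mul_ofReal I) _ j x).trans_eq ?_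
  simp [norm_iteratedFDeriv_cexp_mul_ofReal]

end PlaneWave

section CylSchwartz

variable {m n : ℕ}

theorem isCylSchwartz_comp_snd (g : 𝓢(Fin n → ℝ, ℂ)) :
    IsCylSchwartz fun z : Cyl m n => g z.2 where
  smooth := g.smooth'.comp contDiff_snd
  periodic _ _ _ := rfl
  decay N j := by
    obtain ⟨C, hC⟩ := g.decay' N j
    set π₂ := ContinuousLinearMap.snd ℝ (Fin m → ℝ) (Fin n → ℝ)
    refine ⟨C * ‖π₂‖ ^ j, fun z => ?_⟩
    calc ‖z.2‖ ^ N * ‖iteratedFDeriv ℝ j (g ∘ π₂) z‖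
        ≤ ‖z.2‖ ^ N * (‖iteratedFDeriv ℝ j g z.2‖ * ‖π₂‖ ^ j) := by
          gcongr
          exact norm_iteratedFDeriv_comp_clm_le g.smooth' π₂ j z
      _ = ‖z.2‖ ^ N * ‖iteratedFDeriv ℝ j g z.2‖ * ‖π₂‖ ^ j := by ring
      _ ≤ C * ‖π₂‖ ^ j := by gcongr; exact hC z.2

theorem IsCylSchwartz.mul_of_bounded {e f : Cyl m n → ℂ} (hf : IsCylSchwartz f)
    (he : ContDiff ℝ ∞ e)
    (hper : ∀ (k : Fin m → ℤ) (x : Fin m → ℝ) (y : Fin n → ℝ),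
      e (fun i => x i + 2 * Real.pi * (k i : ℝ), y) = e (x, y))
    (hbdd : ∀ j : ℕ, ∃ B : ℝ, ∀ z, ‖iteratedFDeriv ℝ j e z‖ ≤ B) :
    IsCylSchwartz fun z => e z * f z where
  smooth := he.mul hf.smooth
  periodic k x y := by rw [hper, hf.periodic]
  decay N j := by
    choose B hB using hbdd
    choose C hC using hf.decay N
    refine ⟨∑ i ∈ Finset.range (j + 1), (j.choose i : ℝ) * B i * C (j - i), fun z => ?_⟩
    have hleibniz := norm_iteratedFDeriv_mul_le he hf.smooth z (n := j) (mod_cast le_top)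
    refine (mul_le_mul_of_nonneg_left hleibniz (by positivity)).trans ?_
    rw [Finset.mul_sum]
    refine Finset.sum_le_sum fun i _ => ?_
    have hB0 : 0 ≤ B i := (norm_nonneg _).trans (hB i z)
    calc ‖z.2‖ ^ N * ((j.choose i : ℝ) * ‖iteratedFDeriv ℝ i e z‖ *
          ‖iteratedFDeriv ℝ (j - i) f z‖)
        = (j.choose i : ℝ) * ‖iteratedFDeriv ℝ i e z‖ *
          (‖z.2‖ ^ N * ‖iteratedFDeriv ℝ (j - i) f z‖) := by ring
      _ ≤ (j.choose i : ℝ) * B i * C (j - i) := by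
          gcongr
          · exact hB i z
          · exact hC (j - i) z

theorem IsCylSchwartz.sum {κ : Type*} (S : Finset κ) {f : κ → Cyl m n → ℂ}
    (hf : ∀ k ∈ S, IsCylSchwartz (f k)) : IsCylSchwartz fun z => ∑ k ∈ S, f k z where
  smooth := ContDiff.sum fun k hk => (hf k hk).smooth
  periodic l x y := Finset.sum_congr rfl fun k hk => (hf k hk).periodic l x y
  decay N j := by
    choose! C hC using fun k hk => (hf k hk).decay N j
    refine ⟨∑ k ∈ S, C k, fun z => ?_⟩
    rw [iteratedFDeriv_sum fun k hk => (hf k hk).smooth.of_le (mod_cast le_top),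
      Finset.sum_apply]
    calc ‖z.2‖ ^ N * ‖∑ k ∈ S, iteratedFDeriv ℝ j (f k) z‖
        ≤ ‖z.2‖ ^ N * ∑ k ∈ S, ‖iteratedFDeriv ℝ j (f k) z‖ := by
          gcongr
          exact norm_sum_le _ _
      _ ≤ ∑ k ∈ S, C k := by
          rw [Finset.mul_sum]
          exact Finset.sum_le_sum fun k hk => hC k hk z

theorem isCylSchwartz_planeWave_mul (k : Fin m → ℤ) (g : 𝓢(Fin n → ℝ, ℂ)) :
    IsCylSchwartz fun z : Cyl m n => planeWave (toRealVec k) z.1 * g z.2 := by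
  set π₁ := ContinuousLinearMap.fst ℝ (Fin m → ℝ) (Fin n → ℝ)
  refine (isCylSchwartz_comp_snd g).mul_of_bounded ((contDiff_planeWave _).comp contDiff_fst)
    (fun l x _ => planeWave_toRealVec_add_two_pi k l x)
    fun j => ⟨‖dotForm (toRealVec k)‖ ^ j * ‖π₁‖ ^ j, fun z => ?_⟩
  refine (norm_iteratedFDeriv_comp_clm_le (contDiff_planeWave _) π₁ j z).trans ?_
  gcongr
  exact norm_iteratedFDeriv_planeWave_le _ j _

end CylSchwartz

section InverseFourier

variable {n : ℕ}

/-- The inverse Fourier transform `y ↦ ∫ G(ξ) e^{iξ·y} dξ`, as a Schwartz function. With this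
normalization it is the rescaling by `1 / (2π)` of Mathlib's `𝓕⁻`, which is only available on
inner product spaces. -/
noncomputable def invFourier (G : 𝓢(Fin n → ℝ, ℂ)) : 𝓢(Fin n → ℝ, ℂ) :=
  SchwartzMap.compCLMOfContinuousLinearEquiv ℂ
    ((EuclideanSpace.equiv (Fin n) ℝ).symm.trans
      (ContinuousLinearEquiv.smulLeft (Units.mk0 ((2 * Real.pi)⁻¹ : ℝ) (by positivity))))
    (𝓕⁻ (SchwartzMap.compCLMOfContinuousLinearEquiv ℂ (EuclideanSpace.equiv (Fin n) ℝ) G))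

theorem invFourier_apply_eq_fourierInv (G : 𝓢(Fin n → ℝ, ℂ)) (y : Fin n → ℝ) :
    invFourier G y =
      𝓕⁻ (SchwartzMap.compCLMOfContinuousLinearEquiv ℂ (EuclideanSpace.equiv (Fin n) ℝ) G)
        (WithLp.toLp 2 ((2 * Real.pi)⁻¹ • y)) :=
  rfl

theorem cexp_two_pi_inner_toLp (x y : Fin n → ℝ) :
    Complex.exp (((2 * Real.pi * inner ℝ (WithLp.toLp 2 x) (WithLp.toLp 2 y) : ℝ) : ℂ) * I) =
      planeWave x ((2 * Real.pi) • y) := by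
  rw [planeWave, dotProduct_smul, EuclideanSpace.inner_toLp_toLp, star_trivial, smul_eq_mul,
    mul_comm I, dotProduct_comm y]

theorem invFourier_apply (G : 𝓢(Fin n → ℝ, ℂ)) (y : Fin n → ℝ) :
    invFourier G y = ∫ ξ, G ξ * planeWave ξ y := by
  rw [invFourier_apply_eq_fourierInv, SchwartzMap.fourierInv_coe, Real.fourierInv_eq',
    ← (PiLp.volume_preserving_toLp (Fin n)).integral_comp
      (MeasurableEquiv.toLp 2 _).measurableEmbedding]
  refine integral_congr_ae (.of_forall fun ξ => ?_)
  simp only [cexp_two_pi_inner_toLp, smul_inv_smul₀ Real.two_pi_pos.ne']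
  exact mul_comm _ _

theorem integral_invFourier_mul_planeWave (G : 𝓢(Fin n → ℝ, ℂ)) (ξ : Fin n → ℝ) :
    ∫ y, invFourier G y * planeWave (-ξ) y = (((2 * Real.pi) ^ n : ℝ) : ℂ) * G ξ := by
  set H := SchwartzMap.compCLMOfContinuousLinearEquiv ℂ (EuclideanSpace.equiv (Fin n) ℝ) G
  have hrescale := Measure.integral_comp_inv_smul (volume : Measure (Fin n → ℝ))
    (fun y => 𝓕⁻ H (WithLp.toLp 2 y) * planeWave (-ξ) ((2 * Real.pi) • y)) (2 * Real.pi)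
  rw [Module.finrank_fin_fun, abs_of_nonneg (by positivity), Complex.real_smul] at hrescale
  simp only [smul_inv_smul₀ Real.two_pi_pos.ne'] at hrescale
  have hinversion : G ξ = 𝓕 (𝓕⁻ H) (WithLp.toLp 2 ξ) := by
    rw [FourierTransform.fourier_fourierInv_eq]
    rfl
  rw [hinversion, SchwartzMap.fourier_coe, Real.fourier_eq',
    ← (PiLp.volume_preserving_toLp (Fin n)).integral_comp
      (MeasurableEquiv.toLp 2 _).measurableEmbedding]
  refine hrescale.trans (congrArg _ (integral_congr_ae (.of_forall fun y => ?_)))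
  simp only [← cexp_two_pi_inner_toLp, WithLp.toLp_neg, inner_neg_left, real_inner_comm, neg_mul,
    mul_neg]
  exact mul_comm _ _

end InverseFourier

section WaveSum

variable {m n : ℕ}

theorem cexp_cylPhase (k : Fin m → ℤ) (ξ : Fin n → ℝ) (z : Cyl m n) :
    Complex.exp (I * (cylPhase k ξ z : ℂ)) =
      planeWave (toRealVec k) z.1 * planeWave ξ z.2 := by
  rw [planeWave, planeWave, ← Complex.exp_add, ← mul_add, ← Complex.ofReal_add]
  rfl

theorem cexp_neg_cylPhase (k : Fin m → ℤ) (ξ : Fin n → ℝ) (z : Cyl m n) :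
    Complex.exp (-(I * (cylPhase k ξ z : ℂ))) =
      planeWave (-toRealVec k) z.1 * planeWave (-ξ) z.2 := by
  rw [planeWave, planeWave, ← Complex.exp_add, ← mul_add, ← Complex.ofReal_add, neg_dotProduct,
    neg_dotProduct, ← neg_add, Complex.ofReal_neg, mul_neg]
  rfl

/-- The function on the cylinder whose Fourier transform is `G k` at the frequencies `k ∈ S`
and vanishes at the other ones. -/
noncomputable def waveSum (S : Finset (Fin m → ℤ)) (G : (Fin m → ℤ) → 𝓢(Fin n → ℝ, ℂ))
    (z : Cyl m n) : ℂ :=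
  ∑ k ∈ S, planeWave (toRealVec k) z.1 * invFourier (G k) z.2

theorem isCylSchwartz_waveSum (S : Finset (Fin m → ℤ)) (G : (Fin m → ℤ) → 𝓢(Fin n → ℝ, ℂ)) :
    IsCylSchwartz (waveSum S G) :=
  .sum S fun k _ => isCylSchwartz_planeWave_mul k (invFourier (G k))

theorem integral_cexp_int_mul_two_pi (l : ℤ) :
    ∫ x in Set.Icc (0 : ℝ) (2 * Real.pi), Complex.exp (I * ((l * x : ℝ) : ℂ)) =
      if l = 0 then ((2 * Real.pi : ℝ) : ℂ) else 0 := by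
  rw [integral_Icc_eq_integral_Ioc, ← intervalIntegral.integral_of_le (by positivity)]
  split_ifs with hl
  · simp [hl]
  · have hc : I * (l : ℂ) ≠ 0 := mul_ne_zero Complex.I_ne_zero (mod_cast hl)
    have hperiod : I * (l : ℂ) * ((2 * Real.pi : ℝ) : ℂ) = l * (2 * Real.pi * I) := by
      push_cast
      ring
    simp only [Complex.ofReal_mul, Complex.ofReal_intCast, ← mul_assoc]
    rw [integral_exp_mul_complex hc, hperiod, Complex.exp_int_mul_two_pi_mul_I]
    simp

theorem integral_planeWave_two_pi_cube (k : Fin m → ℤ) :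
    ∫ x in Set.Icc (0 : Fin m → ℝ) (fun _ => 2 * Real.pi), planeWave (toRealVec k) x =
      if k = 0 then (((2 * Real.pi) ^ m : ℝ) : ℂ) else 0 := by
  simp only [planeWave_eq_prod]
  rw [← Set.pi_univ_Icc, volume_pi, Measure.restrict_pi_pi, integral_fintype_prod_eq_prod
    fun i (x : ℝ) => Complex.exp (I * ((toRealVec k i * x : ℝ) : ℂ))]
  simp only [Pi.zero_apply, toRealVec, integral_cexp_int_mul_two_pi]
  split_ifs with hk
  · simp [hk]
  · obtain ⟨i, hi⟩ := Function.ne_iff.mp hk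
    exact Finset.prod_eq_zero (Finset.mem_univ i) (if_neg hi)

theorem integrable_planeWave_mul (k : Fin m → ℤ) (g : 𝓢(Fin n → ℝ, ℂ)) (ξ : Fin n → ℝ) :
    Integrable (fun z : Cyl m n => planeWave (toRealVec k) z.1 * (g z.2 * planeWave (-ξ) z.2))
      (cylMeasure m n) := by
  refine Integrable.mul_prod (f := planeWave (toRealVec k))
    (g := fun y => g y * planeWave (-ξ) y) ?_ ?_
  · exact (continuous_planeWave _).continuousOn.integrableOn_compact isCompact_Icc
  · exact g.integrable.mul_bdd (c := 1) (continuous_planeWave _).aestronglyMeasurable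
      (.of_forall fun y => (norm_planeWave _ y).le)

theorem integral_planeWave_mul (k : Fin m → ℤ) (G : 𝓢(Fin n → ℝ, ℂ)) (ξ : Fin n → ℝ) :
    ∫ z : Cyl m n, planeWave (toRealVec k) z.1 * (invFourier G z.2 * planeWave (-ξ) z.2)
        ∂(cylMeasure m n) =
      if k = 0 then (((2 * Real.pi) ^ (m + n) : ℝ) : ℂ) * G ξ else 0 := by
  rw [cylMeasure, integral_prod_mul (planeWave (toRealVec k))
    fun y => invFourier G y * planeWave (-ξ) y, integral_planeWave_two_pi_cube,
    integral_invFourier_mul_planeWave, ite_mul, zero_mul, pow_add, Complex.ofReal_mul, mul_assoc]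

theorem cylFourier_waveSum (S : Finset (Fin m → ℤ)) (G : (Fin m → ℤ) → 𝓢(Fin n → ℝ, ℂ))
    (k : Fin m → ℤ) (ξ : Fin n → ℝ) :
    cylFourier (waveSum S G) k ξ = if k ∈ S then G k ξ else 0 := by
  have hterm (l : Fin m → ℤ) (z : Cyl m n) :
      planeWave (toRealVec l) z.1 * invFourier (G l) z.2 *
          Complex.exp (-(I * (cylPhase k ξ z : ℂ))) =
        planeWave (toRealVec (l - k)) z.1 * (invFourier (G l) z.2 * planeWave (-ξ) z.2) := by
    have hsub : toRealVec (l - k) = toRealVec l + -toRealVec k := by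
      funext i
      simp [toRealVec, sub_eq_add_neg]
    rw [cexp_neg_cylPhase, hsub, planeWave_add]
    ring
  have hvol : (((2 * Real.pi) ^ (m + n) : ℝ) : ℂ) ≠ 0 :=
    Complex.ofReal_ne_zero.mpr (by positivity)
  simp only [cylFourier, waveSum, Finset.sum_mul, hterm]
  rw [integral_finsetSum _ fun l _ => integrable_planeWave_mul _ _ ξ]
  simp only [integral_planeWave_mul, sub_eq_zero, Finset.sum_ite_eq', mul_ite, mul_zero,
    inv_mul_cancel_left₀ hvol]

theorem cylMultiplier_waveSum (M : (Fin m → ℤ) → (Fin n → ℝ) → ℂ) (S : Finset (Fin m → ℤ))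
    (G : (Fin m → ℤ) → 𝓢(Fin n → ℝ, ℂ)) (z : Cyl m n) :
    cylMultiplier M (waveSum S G) z =
      ∑ k ∈ S, ∫ ξ, M k ξ * G k ξ * Complex.exp (I * (cylPhase k ξ z : ℂ)) := by
  rw [cylMultiplier, tsum_eq_sum (s := S) fun k hk => by simp [cylFourier_waveSum, hk]]
  refine Finset.sum_congr rfl fun k hk => ?_
  simp only [cylFourier_waveSum, hk, if_true]

end WaveSum

/-! ### Constructive interference -/

section LowerBounds

theorem mul_measure_rpow_le_eLpNorm {X ε : Type*} [MeasurableSpace X] [ENorm ε] {μ : Measure X}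
    {f : X → ε} {p c : ℝ≥0∞} {s : Set X} (hs : MeasurableSet s) (hμs : μ s ≠ 0) (hp : p ≠ 0)
    (hf : ∀ x ∈ s, c ≤ ‖f x‖ₑ) : c * μ s ^ (p⁻¹).toReal ≤ eLpNorm f p μ := by
  have hconst := eLpNorm_indicator_const' (c := c) hs hμs hp
  rw [enorm_eq_self, one_div, ← ENNReal.toReal_inv] at hconst
  rw [← hconst]
  refine eLpNorm_mono_enorm fun x => ?_
  by_cases hx : x ∈ s
  · simpa [hx] using hf x hx
  · simp [hx]

theorem le_of_eventually_mul_rpow_le {u : ℕ → ℝ} (hu : Tendsto u atTop atTop) {c C a b : ℝ}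
    (hc : 0 < c) (h : ∀ᶠ j in atTop, c * u j ^ a ≤ C * u j ^ b) : a ≤ b := by
  by_contra! hab
  have hgrow : Tendsto (fun j => c * u j ^ (a - b)) atTop atTop :=
    ((tendsto_rpow_atTop (sub_pos.mpr hab)).comp hu).const_mul_atTop hc
  obtain ⟨j, hj, hlarge, hpos⟩ := (h.and ((hgrow.eventually_gt_atTop C).and
    (hu.eventually_gt_atTop 0))).exists
  rw [Real.rpow_sub hpos, ← mul_div_assoc, lt_div_iff₀ (Real.rpow_pos_of_pos hpos _)] at hlarge
  linarith

variable {κ E : Type*} [MeasurableSpace E] {μ : Measure E}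

theorem sum_integral_mul_cos_le_norm (S : Finset κ) {w θ : κ → E → ℝ} (θ₀ : ℝ)
    (hw : ∀ k ∈ S, Integrable (w k) μ) (hθ : ∀ k ∈ S, Measurable (θ k)) :
    ∑ k ∈ S, ∫ ξ, w k ξ * Real.cos (θ k ξ - θ₀) ∂μ ≤
      ‖∑ k ∈ S, ∫ ξ, (w k ξ : ℂ) * Complex.exp (I * (θ k ξ : ℂ)) ∂μ‖ := by
  set Z := ∑ k ∈ S, ∫ ξ, (w k ξ : ℂ) * Complex.exp (I * (θ k ξ : ℂ)) ∂μ
  have hrotated : Complex.exp (I * ((-θ₀ : ℝ) : ℂ)) * Z =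
      ∑ k ∈ S, ∫ ξ, (w k ξ : ℂ) * Complex.exp (I * ((θ k ξ - θ₀ : ℝ) : ℂ)) ∂μ := by
    simp only [Z, Finset.mul_sum, ← integral_const_mul]
    refine Finset.sum_congr rfl fun k _ => integral_congr_ae (.of_forall fun ξ => ?_)
    simp only [mul_left_comm _ (w k ξ : ℂ), ← Complex.exp_add, ← mul_add, ← Complex.ofReal_add,
      neg_add_eq_sub]
  have hint (k : κ) (hk : k ∈ S) : Integrable
      (fun ξ => (w k ξ : ℂ) * Complex.exp (I * ((θ k ξ - θ₀ : ℝ) : ℂ))) μ := by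
    have hθk := hθ k hk
    refine (hw k hk).ofReal.mul_bdd (c := 1) ?_ (.of_forall fun ξ => ?_)
    · exact (by fun_prop : Measurable fun ξ =>
        Complex.exp (I * ((θ k ξ - θ₀ : ℝ) : ℂ))).aestronglyMeasurable
    · rw [Complex.norm_exp_I_mul_ofReal]
  calc ∑ k ∈ S, ∫ ξ, w k ξ * Real.cos (θ k ξ - θ₀) ∂μ
      = (∑ k ∈ S, ∫ ξ, (w k ξ : ℂ) * Complex.exp (I * ((θ k ξ - θ₀ : ℝ) : ℂ)) ∂μ).re := by
        rw [Complex.re_sum]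
        refine Finset.sum_congr rfl fun k hk => ?_
        refine Eq.trans ?_ (Complex.reCLM.integral_comp_comm (hint k hk))
        simp only [Complex.reCLM_apply, Complex.re_ofReal_mul, mul_comm I,
          Complex.exp_ofReal_mul_I_re]
    _ ≤ ‖Complex.exp (I * ((-θ₀ : ℝ) : ℂ)) * Z‖ := hrotated ▸ Complex.re_le_norm _
    _ = ‖Z‖ := by rw [norm_mul, Complex.norm_exp_I_mul_ofReal, one_mul]

theorem half_sum_integral_le_norm (S : Finset κ) {w θ : κ → E → ℝ} (θ₀ : ℝ)
    (hw : ∀ k ∈ S, Integrable (w k) μ) (hθ : ∀ k ∈ S, Measurable (θ k))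
    (hw0 : ∀ k ∈ S, ∀ ξ, 0 ≤ w k ξ) (hosc : ∀ k ∈ S, ∀ ξ, w k ξ ≠ 0 → |θ k ξ - θ₀| ≤ 1) :
    (∑ k ∈ S, ∫ ξ, w k ξ ∂μ) / 2 ≤
      ‖∑ k ∈ S, ∫ ξ, (w k ξ : ℂ) * Complex.exp (I * (θ k ξ : ℂ)) ∂μ‖ := by
  refine le_trans ?_ (sum_integral_mul_cos_le_norm S θ₀ hw hθ)
  rw [Finset.sum_div]
  refine Finset.sum_le_sum fun k hk => ?_
  rw [← integral_div]
  refine integral_mono ((hw k hk).div_const 2) ?_ fun ξ => ?_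
  · have hθk := hθ k hk
    exact (hw k hk).mul_bdd (c := 1)
      (by fun_prop : Measurable fun ξ => Real.cos (θ k ξ - θ₀)).aestronglyMeasurable
      (.of_forall fun ξ => Real.abs_cos_le_one _)
  · rcases eq_or_ne (w k ξ) 0 with hwξ | hwξ
    · simp [hwξ]
    · have hsq : (θ k ξ - θ₀) ^ 2 ≤ 1 := (sq_le_one_iff_abs_le_one _).mpr (hosc k hk ξ hwξ)
      have hcos : 1 / 2 ≤ Real.cos (θ k ξ - θ₀) := by
        linarith [Real.one_sub_sq_div_two_le_cos (x := θ k ξ - θ₀)]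
      calc w k ξ / 2 = w k ξ * (1 / 2) := by ring
        _ ≤ w k ξ * Real.cos (θ k ξ - θ₀) := mul_le_mul_of_nonneg_left hcos (hw0 k hk ξ)

end LowerBounds

section PhaseBounds

variable {ι : Type*} [Fintype ι] {m n : ℕ}

/-- The square `|ξ|²` of the Euclidean norm (the norm of `ι → ℝ` is the sup norm). -/
def sqSum (ξ : ι → ℝ) : ℝ := ∑ i, ξ i ^ 2

theorem sqSum_nonneg (ξ : ι → ℝ) : 0 ≤ sqSum ξ :=
  Finset.sum_nonneg fun _ _ => sq_nonneg _

theorem cylPhase_eq (k : Fin m → ℤ) (ξ : Fin n → ℝ) (z : Cyl m n) :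
    cylPhase k ξ z = toRealVec k ⬝ᵥ z.1 + ξ ⬝ᵥ z.2 := rfl

theorem freqSq_eq (k : Fin m → ℤ) (ξ : Fin n → ℝ) :
    freqSq k ξ = sqSum (toRealVec k) + sqSum ξ := rfl

theorem freqSq_nonneg (k : Fin m → ℤ) (ξ : Fin n → ℝ) : 0 ≤ freqSq k ξ :=
  add_nonneg (sqSum_nonneg _) (sqSum_nonneg _)

theorem abs_dotProduct_le {a x : ι → ℝ} {R ρ : ℝ} (ha : ∀ i, |a i| ≤ R) (hx : ∀ i, |x i| ≤ ρ) :
    |a ⬝ᵥ x| ≤ Fintype.card ι * (R * ρ) := by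
  calc |a ⬝ᵥ x| ≤ ∑ i, |a i * x i| := Finset.abs_sum_le_sum_abs _ _
    _ ≤ ∑ _i : ι, R * ρ := by
        refine Finset.sum_le_sum fun i _ => ?_
        rw [abs_mul]
        exact mul_le_mul (ha i) (hx i) (abs_nonneg _) ((abs_nonneg _).trans (ha i))
    _ = Fintype.card ι * (R * ρ) := by simp

theorem sqSum_le {ξ : ι → ℝ} {R : ℝ} (hξ : ∀ i, |ξ i| ≤ R) :
    sqSum ξ ≤ Fintype.card ι * R ^ 2 := by
  simpa [sqSum, dotProduct, ← sq] using (le_abs_self _).trans (abs_dotProduct_le hξ hξ)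

theorem abs_cylPhase_le {k : Fin m → ℤ} {ξ : Fin n → ℝ} {z : Cyl m n} {R ρ : ℝ}
    (hk : ∀ i, |toRealVec k i| ≤ R) (hξ : ∀ j, |ξ j| ≤ R) (hx : ∀ i, |z.1 i| ≤ ρ)
    (hy : ∀ j, |z.2 j| ≤ ρ) : |cylPhase k ξ z| ≤ (m + n) * (R * ρ) := by
  have hsum := (abs_add_le _ _).trans (add_le_add (abs_dotProduct_le hk hx)
    (abs_dotProduct_le hξ hy))
  rwa [Fintype.card_fin, Fintype.card_fin, ← add_mul] at hsum

theorem freqSq_le {k : Fin m → ℤ} {ξ : Fin n → ℝ} {R : ℝ} (hk : ∀ i, |toRealVec k i| ≤ R)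
    (hξ : ∀ j, |ξ j| ≤ R) : freqSq k ξ ≤ (m + n) * R ^ 2 := by
  have hsum := add_le_add (sqSum_le hk) (sqSum_le hξ)
  rwa [Fintype.card_fin, Fintype.card_fin, ← add_mul] at hsum

/-- The cube `[0, ρ]^{m+n}` in the cylinder. -/
def cylCube (m n : ℕ) (ρ : ℝ) : Set (Cyl m n) :=
  Set.Icc 0 (fun _ => ρ) ×ˢ Set.Icc 0 (fun _ => ρ)

theorem measurableSet_cylCube (ρ : ℝ) : MeasurableSet (cylCube m n ρ) :=
  measurableSet_Icc.prod measurableSet_Icc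

theorem abs_le_of_mem_cylCube {z : Cyl m n} {ρ : ℝ} (hz : z ∈ cylCube m n ρ) :
    (∀ i, |z.1 i| ≤ ρ) ∧ ∀ j, |z.2 j| ≤ ρ :=
  ⟨fun i => (abs_of_nonneg (hz.1.1 i)).trans_le (hz.1.2 i),
    fun j => (abs_of_nonneg (hz.2.1 j)).trans_le (hz.2.2 j)⟩

theorem cylMeasure_cylCube {ρ : ℝ} (hρ0 : 0 ≤ ρ) (hρ : ρ ≤ 2 * Real.pi) :
    cylMeasure m n (cylCube m n ρ) = ENNReal.ofReal (ρ ^ (m + n)) := by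
  have hinter : Set.Icc (0 : Fin m → ℝ) (fun _ => ρ) ∩ Set.Icc 0 (fun _ => 2 * Real.pi) =
      Set.Icc 0 (fun _ => ρ) :=
    Set.inter_eq_left.mpr (Set.Icc_subset_Icc_right fun _ => hρ)
  rw [cylMeasure, cylCube, Measure.prod_prod, Measure.restrict_apply measurableSet_Icc, hinter,
    Real.volume_Icc_pi, Real.volume_Icc_pi, pow_add, ENNReal.ofReal_mul (by positivity)]
  simp [ENNReal.ofReal_pow hρ0]

theorem timeMeasure_Icc {a b : ℝ} (ha : 0 ≤ a) (hb : b ≤ 1) :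
    timeMeasure (Set.Icc a b) = ENNReal.ofReal (b - a) := by
  rw [timeMeasure, Measure.restrict_apply measurableSet_Icc,
    Set.inter_eq_left.mpr (Set.Icc_subset_Icc ha hb), Real.volume_Icc]

end PhaseBounds

/-! ### Lattice frequencies and the modulation norm -/

section LatticeWave

variable {m n : ℕ}

/-- A smooth bump of width `1/8` around the origin, narrow enough to meet a single cell of a unit
cube partition. -/
noncomputable def cubeBump (n : ℕ) : ContDiffBump (0 : Fin n → ℝ) where
  rIn := 1 / 16
  rOut := 1 / 8
  rIn_pos := by norm_num
  rIn_lt_rOut := by norm_num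

theorem abs_lt_of_cubeBump_ne_zero {ξ : Fin n → ℝ} (hξ : cubeBump n ξ ≠ 0) (j : Fin n) :
    |ξ j| < 1 / 8 := by
  have hmem : ξ ∈ Function.support (cubeBump n) := hξ
  rw [ContDiffBump.support_eq, mem_ball_zero_iff] at hmem
  exact (norm_le_pi_norm ξ j).trans_lt hmem

/-- `cubeBump` as a complex valued Schwartz function. -/
noncomputable def freqBump (n : ℕ) : 𝓢(Fin n → ℝ, ℂ) :=
  HasCompactSupport.toSchwartzMap (f := fun ξ => ((cubeBump n ξ : ℝ) : ℂ))
    ((cubeBump n).hasCompactSupport.comp_left (g := Complex.ofReal) Complex.ofReal_zero)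
    (Complex.ofRealCLM.contDiff.comp (cubeBump n).contDiff)

/-- The sum of the translates of `cubeBump` by the lattice points in `T`. -/
noncomputable def latticeBump (T : Finset (Fin n → ℤ)) (ξ : Fin n → ℝ) : ℝ :=
  ∑ b ∈ T, cubeBump n (ξ - toRealVec b)

/-- The function on the cylinder whose Fourier transform has a bump at each lattice point of
`S × T`. -/
noncomputable def latticeWave (S : Finset (Fin m → ℤ)) (T : Finset (Fin n → ℤ)) : Cyl m n → ℂ :=
  waveSum S fun _ => ∑ b ∈ T, SchwartzMap.compSubConstCLM ℂ (toRealVec b) (freqBump n)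

theorem sum_compSubConst_freqBump_apply (T : Finset (Fin n → ℤ)) (ξ : Fin n → ℝ) :
    (∑ b ∈ T, SchwartzMap.compSubConstCLM ℂ (toRealVec b) (freqBump n)) ξ =
      ((latticeBump T ξ : ℝ) : ℂ) := by
  rw [latticeBump, _root_.sum_apply, Complex.ofReal_sum]
  rfl

theorem isCylSchwartz_latticeWave (S : Finset (Fin m → ℤ)) (T : Finset (Fin n → ℤ)) :
    IsCylSchwartz (latticeWave S T) :=
  isCylSchwartz_waveSum _ _

theorem integrable_latticeBump (T : Finset (Fin n → ℤ)) : Integrable (latticeBump T) :=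
  integrable_finsetSum _ fun _ _ => (cubeBump n).integrable.comp_sub_right _

theorem integral_latticeBump (T : Finset (Fin n → ℤ)) :
    ∫ ξ, latticeBump T ξ = T.card * ∫ ξ, cubeBump n ξ := by
  unfold latticeBump
  rw [integral_finsetSum _ fun b _ => (cubeBump n).integrable.comp_sub_right _,
    Finset.sum_congr rfl fun b _ =>
      integral_sub_right_eq_self (fun ξ => cubeBump n ξ) (toRealVec b)]
  simp

theorem exists_of_latticeBump_ne_zero {T : Finset (Fin n → ℤ)} {ξ : Fin n → ℝ}
    (hξ : latticeBump T ξ ≠ 0) : ∃ b ∈ T, ∀ j, |ξ j - b j| < 1 / 8 := by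
  obtain ⟨b, hb, hbξ⟩ := Finset.exists_ne_zero_of_sum_ne_zero hξ
  exact ⟨b, hb, abs_lt_of_cubeBump_ne_zero hbξ⟩

theorem schrodinger_latticeWave (S : Finset (Fin m → ℤ)) (T : Finset (Fin n → ℤ)) (t : ℝ)
    (z : Cyl m n) :
    schrodinger t (latticeWave S T) z = ∑ k ∈ S, ∫ ξ, (latticeBump T ξ : ℂ) *
      Complex.exp (I * ((cylPhase k ξ z - t * freqSq k ξ : ℝ) : ℂ)) := by
  rw [schrodinger, latticeWave, cylMultiplier_waveSum]
  refine Finset.sum_congr rfl fun k _ => integral_congr_ae (.of_forall fun ξ => ?_)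
  simp only [sum_compSubConst_freqBump_apply]
  rw [mul_comm (Complex.exp _), mul_assoc, ← Complex.exp_add]
  push_cast
  ring_nf

theorem le_norm_schrodinger_latticeWave {S : Finset (Fin m → ℤ)} {T : Finset (Fin n → ℤ)}
    {t θ₀ : ℝ} {z : Cyl m n}
    (hosc : ∀ k ∈ S, ∀ ξ, latticeBump T ξ ≠ 0 → |cylPhase k ξ z - t * freqSq k ξ - θ₀| ≤ 1) :
    S.card * (T.card * ∫ ξ, cubeBump n ξ) / 2 ≤ ‖schrodinger t (latticeWave S T) z‖ := by
  have hmeas (k : Fin m → ℤ) : Measurable fun ξ => cylPhase k ξ z - t * freqSq k ξ := by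
    unfold cylPhase freqSq
    fun_prop
  have hbound := half_sum_integral_le_norm S θ₀ (fun _ _ => integrable_latticeBump T)
    (fun k _ => hmeas k) (fun _ _ ξ => Finset.sum_nonneg fun _ _ => (cubeBump n).nonneg) hosc
  rw [schrodinger_latticeWave]
  simpa only [integral_latticeBump, Finset.sum_const, nsmul_eq_mul] using hbound

end LatticeWave

section UnitCubePartition

variable {m n : ℕ} {σ : Cyl m n → ℝ}

theorem intCast_eq_of_abs_sub_lt_one {a b : ℤ} (h : |(a : ℝ) - b| < 1) : a = b := by
  rw [← sub_eq_zero, ← Int.abs_lt_one_iff]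
  exact_mod_cast h

theorem IsUnitCubePartition.eq_of_latticeTranslate_ne_zero (hσ : IsUnitCubePartition σ)
    {K : (Fin m → ℤ) × (Fin n → ℤ)} {k : Fin m → ℤ} {b : Fin n → ℤ} {ξ : Fin n → ℝ}
    (hξ : ∀ j, |ξ j - b j| < 1 / 8) (hK : latticeTranslate σ K (toRealVec k, ξ) ≠ 0) :
    K = (k, b) := by
  obtain ⟨hx, hy⟩ := hσ.support (subset_tsupport σ hK)
  simp only [Set.mem_Ico, toRealVec] at hx hy
  refine Prod.ext (funext fun i => ?_) (funext fun j => ?_) <;>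
    refine intCast_eq_of_abs_sub_lt_one (abs_lt.mpr ?_)
  · constructor <;> linarith [hx i]
  · have hξj := abs_lt.mp (hξ j)
    constructor <;> linarith [hy j]

theorem IsUnitCubePartition.latticeTranslate_eq_one (hσ : IsUnitCubePartition σ)
    {k : Fin m → ℤ} {b : Fin n → ℤ} {ξ : Fin n → ℝ} (hξ : ∀ j, |ξ j - b j| < 1 / 8) :
    latticeTranslate σ (k, b) (toRealVec k, ξ) = 1 := by
  refine (hasSum_single (k, b) fun K hK => ?_).unique (hσ.sum_eq_one (toRealVec k, ξ))
  by_contra hne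
  exact hK (hσ.eq_of_latticeTranslate_ne_zero hξ hne)

theorem IsUnitCubePartition.latticeTranslate_mul_cubeBump (hσ : IsUnitCubePartition σ)
    (K : (Fin m → ℤ) × (Fin n → ℤ)) (k : Fin m → ℤ) (b : Fin n → ℤ) (ξ : Fin n → ℝ) :
    latticeTranslate σ K (toRealVec k, ξ) * cubeBump n (ξ - toRealVec b) =
      if K = (k, b) then cubeBump n (ξ - toRealVec b) else 0 := by
  rcases eq_or_ne (cubeBump n (ξ - toRealVec b)) 0 with hbump | hbump
  · simp [hbump]
  · have hξ : ∀ j, |ξ j - b j| < 1 / 8 := abs_lt_of_cubeBump_ne_zero hbump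
    split_ifs with hK
    · rw [hK, hσ.latticeTranslate_eq_one hξ, one_mul]
    · rw [of_not_not (mt (hσ.eq_of_latticeTranslate_ne_zero hξ) hK), zero_mul]

theorem IsUnitCubePartition.latticeTranslate_mul_latticeBump (hσ : IsUnitCubePartition σ)
    (K : (Fin m → ℤ) × (Fin n → ℤ)) (k : Fin m → ℤ) (T : Finset (Fin n → ℤ)) (ξ : Fin n → ℝ) :
    latticeTranslate σ K (toRealVec k, ξ) * latticeBump T ξ =
      if K.1 = k ∧ K.2 ∈ T then cubeBump n (ξ - toRealVec K.2) else 0 := by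
  rw [latticeBump, Finset.mul_sum]
  simp only [hσ.latticeTranslate_mul_cubeBump, Prod.ext_iff, ite_and]
  by_cases hk : K.1 = k <;> simp [hk]

theorem integral_comp_sub_mul_planeWave (G : 𝓢(Fin n → ℝ, ℂ)) (b y : Fin n → ℝ) :
    ∫ ξ, G (ξ - b) * planeWave ξ y = planeWave b y * invFourier G y := by
  rw [invFourier_apply, ← integral_const_mul, ← integral_add_right_eq_self _ b]
  refine integral_congr_ae (.of_forall fun ξ => ?_)
  simp only [add_sub_cancel_right, planeWave_add]
  ring

theorem boxOp_latticeWave (hσ : IsUnitCubePartition σ) (K : (Fin m → ℤ) × (Fin n → ℤ))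
    (S : Finset (Fin m → ℤ)) (T : Finset (Fin n → ℤ)) (z : Cyl m n) :
    boxOp σ K (latticeWave S T) z =
      if K ∈ S ×ˢ T then planeWave (toRealVec K.1) z.1 *
        (planeWave (toRealVec K.2) z.2 * invFourier (freqBump n) z.2) else 0 := by
  have hterm (k : Fin m → ℤ) :
      ∫ ξ, (latticeTranslate σ K (toRealVec k, ξ) : ℂ) * (latticeBump T ξ : ℂ) *
          Complex.exp (I * (cylPhase k ξ z : ℂ)) =
        if k = K.1 then if K.2 ∈ T then planeWave (toRealVec K.1) z.1 *
          (planeWave (toRealVec K.2) z.2 * invFourier (freqBump n) z.2) else 0 else 0 := by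
    simp only [← Complex.ofReal_mul, hσ.latticeTranslate_mul_latticeBump, cexp_cylPhase]
    by_cases hk : k = K.1
    · by_cases hb : K.2 ∈ T
      · simp only [hk, hb, and_self, if_true, mul_left_comm _ (planeWave (toRealVec K.1) z.1)]
        rw [integral_const_mul, ← integral_comp_sub_mul_planeWave]
        rfl
      · simp [hb]
    · simp [hk, Ne.symm hk]
  rw [boxOp, latticeWave, cylMultiplier_waveSum]
  simp only [sum_compSubConst_freqBump_apply]
  refine (Finset.sum_congr rfl fun k _ => hterm k).trans ?_
  rw [Finset.sum_ite_eq', ← ite_and]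
  simp only [Finset.mem_product]

end UnitCubePartition

section ModulationTest

variable {m n : ℕ} {σ : Cyl m n → ℝ}

/-- The common `L^p` norm of all the nonzero pieces `□_K f`, where `f` is a `latticeWave`. -/
noncomputable def bumpNorm (m n : ℕ) (p : ℝ≥0∞) : ℝ≥0∞ :=
  eLpNorm (fun z : Cyl m n => invFourier (freqBump n) z.2) p (cylMeasure m n)

theorem eLpNorm_comp_snd_ne_top (g : 𝓢(Fin n → ℝ, ℂ)) (p : ℝ≥0∞) :
    eLpNorm (fun z : Cyl m n => g z.2) p (cylMeasure m n) ≠ ⊤ := by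
  have hcube : IsFiniteMeasure ((volume : Measure (Fin m → ℝ)).restrict
      (Set.Icc 0 (fun _ => 2 * Real.pi))) :=
    isFiniteMeasure_restrict.mpr isCompact_Icc.measure_lt_top.ne
  exact ((g.memLp p volume).comp_snd _).eLpNorm_ne_top

theorem eLpNorm_boxOp_latticeWave (hσ : IsUnitCubePartition σ) (K : (Fin m → ℤ) × (Fin n → ℤ))
    (S : Finset (Fin m → ℤ)) (T : Finset (Fin n → ℤ)) (p : ℝ≥0∞) :
    eLpNorm (boxOp σ K (latticeWave S T)) p (cylMeasure m n) =
      if K ∈ S ×ˢ T then bumpNorm m n p else 0 := by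
  rw [funext (boxOp_latticeWave hσ K S T)]
  split_ifs
  · exact eLpNorm_congr_norm_ae (.of_forall fun z => by simp [norm_planeWave])
  · exact eLpNorm_zero

theorem modulationNorm_latticeWave_le (hσ : IsUnitCubePartition σ) {S : Finset (Fin m → ℤ)}
    {T : Finset (Fin n → ℤ)} {α B : ℝ} (hB : ∀ K ∈ S ×ˢ T, japanese K ^ α ≤ B) (p q : ℝ≥0∞) :
    modulationNorm σ α p q (latticeWave S T) ≤
      ENNReal.ofReal B * bumpNorm m n p * (S.card * T.card : ℝ≥0∞) ^ (q⁻¹).toReal := by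
  have hconst := eLpNorm_indicator_const_le (μ := Measure.count)
    (s := ((S ×ˢ T : Finset _) : Set ((Fin m → ℤ) × (Fin n → ℤ))))
    (ENNReal.ofReal B * bumpNorm m n p) q
  rw [Measure.count_apply_finset, Finset.card_product, enorm_eq_self, one_div,
    ← ENNReal.toReal_inv, Nat.cast_mul] at hconst
  refine le_trans (eLpNorm_mono_enorm fun K => ?_) hconst
  rw [enorm_eq_self, enorm_eq_self, eLpNorm_boxOp_latticeWave hσ]
  by_cases hK : K ∈ S ×ˢ T
  · rw [if_pos hK, Set.indicator_of_mem (Finset.mem_coe.mpr hK)]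
    gcongr
    exact hB K hK
  · rw [if_neg hK, mul_zero]
    exact zero_le

theorem le_spaceTimeNorm {p : ℝ≥0∞} (hp : p ≠ 0) {f : Cyl m n → ℂ} {ρ τ c : ℝ}
    (hρ : ρ ∈ Set.Ioc 0 1) (hτ : τ ∈ Set.Ioc 0 1)
    (hc : ∀ z ∈ cylCube m n ρ, ∀ t ∈ Set.Icc 0 τ, c ≤ ‖schrodinger t f z‖) :
    ENNReal.ofReal c * ENNReal.ofReal (ρ ^ (m + n) * τ) ^ (p⁻¹).toReal ≤ spaceTimeNorm p f := by
  obtain ⟨hρ0, hρ1⟩ := hρ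
  have hvolume : ((cylMeasure m n).prod timeMeasure) (cylCube m n ρ ×ˢ Set.Icc 0 τ) =
      ENNReal.ofReal (ρ ^ (m + n) * τ) := by
    have : SFinite timeMeasure := by
      unfold timeMeasure
      infer_instance
    rw [Measure.prod_prod, cylMeasure_cylCube hρ0.le (by linarith [Real.pi_gt_three]),
      timeMeasure_Icc le_rfl hτ.2, sub_zero, ENNReal.ofReal_mul (by positivity)]
  rw [← hvolume]
  refine mul_measure_rpow_le_eLpNorm ((measurableSet_cylCube ρ).prod measurableSet_Icc) ?_ hp ?_
  · rw [hvolume]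
    exact (ENNReal.ofReal_pos.mpr (mul_pos (pow_pos hρ0 _) hτ.1)).ne'
  · rintro ⟨z, t⟩ ⟨hz, ht⟩
    rw [← ofReal_norm]
    exact ENNReal.ofReal_le_ofReal (hc z hz t ht)

theorem latticeWave_modulation_bound (hσ : IsUnitCubePartition σ) {p q : ℝ≥0∞} (hp : p ≠ 0)
    {α : ℝ} {C : ℝ≥0} (hC : ∀ f : Cyl m n → ℂ, IsCylSchwartz f →
      spaceTimeNorm p f ≤ C * modulationNorm σ α p q f)
    {S : Finset (Fin m → ℤ)} {T : Finset (Fin n → ℤ)} {ρ τ B : ℝ} (hρ : ρ ∈ Set.Ioc 0 1)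
    (hτ : τ ∈ Set.Ioc 0 1) (hB0 : 0 ≤ B) (hB : ∀ K ∈ S ×ˢ T, japanese K ^ α ≤ B)
    (hosc : ∀ z ∈ cylCube m n ρ, ∀ t ∈ Set.Icc 0 τ, ∃ θ₀, ∀ k ∈ S, ∀ ξ, latticeBump T ξ ≠ 0 →
      |cylPhase k ξ z - t * freqSq k ξ - θ₀| ≤ 1) :
    S.card * (T.card * ∫ ξ, cubeBump n ξ) / 2 * (ρ ^ (m + n) * τ) ^ (p⁻¹).toReal ≤
      C * (B * (bumpNorm m n p).toReal * (S.card * T.card) ^ (q⁻¹).toReal) := by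
  have hρτ : 0 ≤ ρ ^ (m + n) * τ := mul_nonneg (pow_nonneg hρ.1.le _) hτ.1.le
  have hmass : 0 ≤ S.card * (T.card * ∫ ξ, cubeBump n ξ) / 2 := by
    have := (cubeBump n).integral_pos (μ := volume)
    positivity
  have hlower := le_spaceTimeNorm hp hρ hτ fun z hz t ht =>
    let ⟨_, hθ₀⟩ := hosc z hz t ht
    le_norm_schrodinger_latticeWave hθ₀
  have hupper := modulationNorm_latticeWave_le hσ hB p q
  have hfinite : ENNReal.ofReal B * bumpNorm m n p * (S.card * T.card : ℝ≥0∞) ^ (q⁻¹).toReal ≠ ⊤ :=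
    ENNReal.mul_ne_top (ENNReal.mul_ne_top ENNReal.ofReal_ne_top (eLpNorm_comp_snd_ne_top _ p))
      (ENNReal.rpow_ne_top_of_nonneg ENNReal.toReal_nonneg
        (ENNReal.mul_ne_top (ENNReal.natCast_ne_top _) (ENNReal.natCast_ne_top _)))
  have hchain := ENNReal.toReal_mono (ENNReal.mul_ne_top ENNReal.coe_ne_top hfinite)
    ((hlower.trans (hC _ (isCylSchwartz_latticeWave S T))).trans (mul_le_mul_right hupper _))
  simpa only [ENNReal.toReal_mul, ← ENNReal.toReal_rpow, ENNReal.toReal_ofReal hmass,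
    ENNReal.toReal_ofReal hρτ, ENNReal.toReal_ofReal hB0, ENNReal.coe_toReal,
    ENNReal.toReal_natCast] using hchain

theorem le_japanese_const (hm : 1 ≤ m) (L : ℕ) :
    (L : ℝ) ≤ japanese ((fun _ => (L : ℤ), 0) : (Fin m → ℤ) × (Fin n → ℤ)) := by
  refine Real.le_sqrt_of_sq_le ?_
  have hmL : 1 * (L : ℝ) ^ 2 ≤ m * (L : ℝ) ^ 2 := by gcongr; exact_mod_cast hm
  simp only [freqSq, Int.cast_natCast, Finset.sum_const, Finset.card_univ, Fintype.card_fin,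
    nsmul_eq_mul, Pi.zero_apply, Int.cast_zero, ne_eq, OfNat.ofNat_ne_zero, not_false_eq_true,
    zero_pow, mul_zero, add_zero]
  linarith

theorem abs_dotProduct_sub_mul_sqSum_le_one {ξ y : Fin n → ℝ} {ρ t : ℝ} (hρ : n * ρ ≤ 1)
    (hξ : ∀ j, |ξ j| ≤ 1 / 8) (hy : ∀ j, |y j| ≤ ρ) (ht : t ∈ Set.Icc 0 ρ) :
    |ξ ⬝ᵥ y - t * sqSum ξ| ≤ 1 := by
  have hdot := abs_le.mp (abs_dotProduct_le hξ hy)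
  have hsq := sqSum_le hξ
  have htsq : t * sqSum ξ ≤ ρ * (n * (1 / 8) ^ 2) := by
    rw [Fintype.card_fin] at hsq
    exact mul_le_mul ht.2 hsq (sqSum_nonneg ξ) (ht.1.trans ht.2)
  have htsq0 : 0 ≤ t * sqSum ξ := mul_nonneg ht.1 (sqSum_nonneg ξ)
  rw [Fintype.card_fin] at hdot
  exact abs_le.mpr ⟨by nlinarith [hdot.1], by nlinarith [hdot.2]⟩

theorem modulation_exponent_nonneg (hm : 1 ≤ m) (hσ : IsUnitCubePartition σ) {p q : ℝ≥0∞}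
    (hp : p ≠ 0) {α : ℝ} {C : ℝ≥0} (hC : ∀ f : Cyl m n → ℂ, IsCylSchwartz f →
      spaceTimeNorm p f ≤ C * modulationNorm σ α p q f) : 0 ≤ α := by
  set K : ℕ → (Fin m → ℤ) × (Fin n → ℤ) := fun L => (fun _ => (L : ℤ), 0)
  have hK : Tendsto (fun L => japanese (K L)) atTop atTop :=
    tendsto_atTop_mono (le_japanese_const hm) tendsto_natCast_atTop_atTop
  set ρ : ℝ := 1 / (n + 1) with hρ_def
  have hρ0 : 0 < ρ := by positivity
  have hρ1 : ρ ≤ 1 := div_le_one_of_le₀ (by linarith [n.cast_nonneg (α := ℝ)]) (by positivity)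
  have hnρ : n * ρ ≤ 1 := by
    rw [hρ_def, mul_one_div]
    exact div_le_one_of_le₀ (by linarith) (by positivity)
  have hbump : 0 < ∫ ξ, cubeBump n ξ := (cubeBump n).integral_pos
  refine le_of_eventually_mul_rpow_le hK (C := C * (bumpNorm m n p).toReal)
    (c := (∫ ξ, cubeBump n ξ) / 2 * (ρ ^ (m + n) * ρ) ^ (p⁻¹).toReal) (by positivity)
    (.of_forall fun L => ?_)
  have hbound := latticeWave_modulation_bound hσ hp hC (S := {(K L).1}) (T := {(K L).2})
    ⟨hρ0, hρ1⟩ ⟨hρ0, hρ1⟩ (B := japanese (K L) ^ α) (Real.rpow_nonneg (Real.sqrt_nonneg _) _)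
    (by simp) fun z hz t ht =>
      ⟨toRealVec (K L).1 ⬝ᵥ z.1 - t * sqSum (toRealVec (K L).1), fun k hk ξ hξ => ?_⟩
  · simp only [Finset.card_singleton, Nat.cast_one, one_mul, Real.one_rpow, mul_one] at hbound
    rw [Real.rpow_zero, mul_one]
    exact hbound.trans_eq (by ring)
  · obtain ⟨b, hb, hbξ⟩ := exists_of_latticeBump_ne_zero hξ
    have hξ' (j : Fin n) : |ξ j| ≤ 1 / 8 := by
      simpa [Finset.mem_singleton.mp hb, K] using (hbξ j).le
    convert abs_dotProduct_sub_mul_sqSum_le_one hnρ hξ' (abs_le_of_mem_cylCube hz).2 ht using 2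
    rw [Finset.mem_singleton.mp hk, cylPhase_eq, freqSq_eq]
    ring

end ModulationTest

section LatticeCube

variable {m n : ℕ} {σ : Cyl m n → ℝ}

/-- The lattice cube `{0, …, N - 1}^d`. -/
noncomputable def latticeCube (d N : ℕ) : Finset (Fin d → ℤ) :=
  Fintype.piFinset fun _ => Finset.Ico 0 (N : ℤ)

theorem card_latticeCube (d N : ℕ) : (latticeCube d N).card = N ^ d := by
  simp [latticeCube, Fintype.card_piFinset]

theorem abs_toRealVec_le_of_mem_latticeCube {d N : ℕ} {k : Fin d → ℤ} (hk : k ∈ latticeCube d N)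
    (i : Fin d) : |toRealVec k i| ≤ N - 1 := by
  obtain ⟨hk0, hkN⟩ := Finset.mem_Ico.mp (Fintype.mem_piFinset.mp hk i)
  rw [toRealVec, abs_of_nonneg (Int.cast_nonneg hk0), le_sub_iff_add_le]
  exact_mod_cast hkN

theorem abs_le_of_latticeBump_latticeCube_ne_zero {N : ℕ} {ξ : Fin n → ℝ}
    (hξ : latticeBump (latticeCube n N) ξ ≠ 0) (j : Fin n) : |ξ j| ≤ N := by
  obtain ⟨b, hb, hbξ⟩ := exists_of_latticeBump_ne_zero hξ
  have hbj := abs_toRealVec_le_of_mem_latticeCube hb j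
  rw [toRealVec] at hbj
  linarith [abs_sub_abs_le_abs_sub (ξ j) (b j), hbξ j]

theorem japanese_le_of_mem_latticeCube {N : ℕ} (hN : 1 ≤ N) {K : (Fin m → ℤ) × (Fin n → ℤ)}
    (hK : K ∈ latticeCube m N ×ˢ latticeCube n N) :
    japanese K ≤ Real.sqrt (1 + (m + n)) * N := by
  obtain ⟨hk, hb⟩ := Finset.mem_product.mp hK
  have hN' : (1 : ℝ) ≤ N := Nat.one_le_cast.mpr hN
  have hfreq : freqSq K.1 (toRealVec K.2) ≤ (m + n) * (N : ℝ) ^ 2 := freqSq_le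
    (fun i => (abs_toRealVec_le_of_mem_latticeCube hk i).trans (by linarith))
    (fun j => (abs_toRealVec_le_of_mem_latticeCube hb j).trans (by linarith))
  refine Real.sqrt_le_iff.mpr ⟨by positivity, ?_⟩
  rw [mul_pow, Real.sq_sqrt (by positivity), add_mul, one_mul]
  exact add_le_add (one_le_pow₀ hN') hfreq

theorem abs_cylPhase_sub_mul_freqSq_le_one {k : Fin m → ℤ} {ξ : Fin n → ℝ} {z : Cyl m n}
    {R ρ τ t : ℝ} (hk : ∀ i, |toRealVec k i| ≤ R) (hξ : ∀ j, |ξ j| ≤ R)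
    (hz : z ∈ cylCube m n ρ) (ht : t ∈ Set.Icc 0 τ) (hρ : (m + n) * (R * ρ) ≤ 1 / 2)
    (hτ : τ * ((m + n) * R ^ 2) ≤ 1 / 2) : |cylPhase k ξ z - t * freqSq k ξ| ≤ 1 := by
  have hphase := abs_le.mp ((abs_cylPhase_le hk hξ (abs_le_of_mem_cylCube hz).1
    (abs_le_of_mem_cylCube hz).2).trans hρ)
  have htime0 : 0 ≤ t * freqSq k ξ := mul_nonneg ht.1 (freqSq_nonneg k ξ)
  have htime : t * freqSq k ξ ≤ 1 / 2 :=
    (mul_le_mul ht.2 (freqSq_le hk hξ) (freqSq_nonneg k ξ) (ht.1.trans ht.2)).trans hτ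
  exact abs_le.mpr ⟨by linarith [hphase.1], by linarith [hphase.2]⟩

theorem pow_inv_mul_mul_inv_mul_sq (a : ℝ) {x : ℝ} (hx : 0 < x) (d : ℕ) :
    (a * x)⁻¹ ^ d * (a * x ^ 2)⁻¹ = (a ^ (d + 1))⁻¹ * x ^ (-((d : ℝ) + 2)) := by
  have hpow : x ^ ((d : ℝ) + 2) = x ^ d * x ^ 2 := by
    rw [Real.rpow_add hx, Real.rpow_natCast, Real.rpow_ofNat]
  rw [Real.rpow_neg hx.le, hpow, inv_pow, ← mul_inv, ← mul_inv, mul_pow, pow_succ]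
  ring

theorem modulation_bound_latticeCube (hσ : IsUnitCubePartition σ) {p q : ℝ≥0∞} (hp : p ≠ 0)
    {α : ℝ} (hα : 0 ≤ α) {C : ℝ≥0} (hC : ∀ f : Cyl m n → ℂ, IsCylSchwartz f →
      spaceTimeNorm p f ≤ C * modulationNorm σ α p q f) {N : ℕ} (hN : 1 ≤ N) {a : ℝ}
    (ha1 : 1 ≤ a) (ha : 2 * (m + n) ≤ a) :
    (N : ℝ) ^ m * N ^ n * (∫ ξ, cubeBump n ξ) / 2 *
        ((a * N)⁻¹ ^ (m + n) * (a * N ^ 2)⁻¹) ^ (p⁻¹).toReal ≤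
      C * ((Real.sqrt (1 + (m + n)) * N) ^ α * (bumpNorm m n p).toReal *
        (N ^ m * N ^ n) ^ (q⁻¹).toReal) := by
  have hN' : (1 : ℝ) ≤ N := Nat.one_le_cast.mpr hN
  have hdim : (m + n : ℝ) * a⁻¹ ≤ 1 / 2 := by
    rw [← div_eq_mul_inv, div_le_iff₀ (by linarith)]
    linarith
  have hbound := latticeWave_modulation_bound hσ hp hC (ρ := (a * N)⁻¹) (τ := (a * N ^ 2)⁻¹)
    (S := latticeCube m N) (T := latticeCube n N) (B := (Real.sqrt (1 + (m + n)) * N) ^ α)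
    ⟨by positivity, inv_le_one_of_one_le₀ (one_le_mul_of_one_le_of_one_le ha1 hN')⟩
    ⟨by positivity, inv_le_one_of_one_le₀ (one_le_mul_of_one_le_of_one_le ha1 (one_le_pow₀ hN'))⟩
    (by positivity)
    (fun K hK => Real.rpow_le_rpow (Real.sqrt_nonneg _) (japanese_le_of_mem_latticeCube hN hK) hα)
    fun z hz t ht => ⟨0, fun k hk ξ hξ => ?_⟩
  · simpa only [card_latticeCube, Nat.cast_pow, mul_assoc] using hbound
  · rw [sub_zero]
    refine abs_cylPhase_sub_mul_freqSq_le_one (R := N)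
      (fun i => (abs_toRealVec_le_of_mem_latticeCube hk i).trans (by linarith))
      (abs_le_of_latticeBump_latticeCube_ne_zero hξ) hz ht ?_ ?_
    · rwa [mul_inv, mul_left_comm (N : ℝ), mul_inv_cancel₀ (by positivity), mul_one]
    · rwa [mul_comm, mul_inv, mul_assoc, mul_left_comm (_ ^ 2), mul_inv_cancel₀ (by positivity),
        mul_one]

theorem modulation_exponent_ge (hσ : IsUnitCubePartition σ) {p q : ℝ≥0∞} (hp : p ≠ 0) {α : ℝ}
    (hα : 0 ≤ α) {C : ℝ≥0} (hC : ∀ f : Cyl m n → ℂ, IsCylSchwartz f →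
      spaceTimeNorm p f ≤ C * modulationNorm σ α p q f) :
    ((m : ℝ) + n) * (1 - (p⁻¹).toReal - (q⁻¹).toReal) - 2 * (p⁻¹).toReal ≤ α := by
  set D : ℝ := (m : ℝ) + n with hD
  set a : ℝ := 2 * (D + 1)
  set Λ := ∫ ξ, cubeBump n ξ
  have hΛ : 0 < Λ := (cubeBump n).integral_pos
  have : 0 ≤ D := by positivity
  suffices D + -(D + 2) * (p⁻¹).toReal ≤ α + D * (q⁻¹).toReal by linarith
  refine le_of_eventually_mul_rpow_le tendsto_natCast_atTop_atTop
    (c := Λ / 2 * (a ^ (m + n + 1))⁻¹ ^ (p⁻¹).toReal)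
    (C := C * (bumpNorm m n p).toReal * Real.sqrt (1 + D) ^ α) (by positivity) ?_
  filter_upwards [eventually_ge_atTop 1] with N hN
  have hN0 : (0 : ℝ) < N := Nat.cast_pos.mpr hN
  have hpow : (N : ℝ) ^ m * (N : ℝ) ^ n = (N : ℝ) ^ D := by
    rw [hD, Real.rpow_add hN0, Real.rpow_natCast, Real.rpow_natCast]
  have hbound := modulation_bound_latticeCube hσ hp hα hC hN (a := a) (by linarith) (by linarith)
  rw [pow_inv_mul_mul_inv_mul_sq _ hN0, Nat.cast_add, ← hD,
    Real.mul_rpow (by positivity) (by positivity), ← Real.rpow_mul hN0.le, hpow,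
    ← Real.rpow_mul hN0.le, Real.mul_rpow (by positivity) (by positivity)] at hbound
  rw [Real.rpow_add hN0 D, Real.rpow_add hN0 α]
  linarith

end LatticeCube

/-! ### Quadratic Weyl sums -/

theorem sum_range_sum_range_eq_diagonals {A : Type*} [AddCommGroup A] (F : ℕ → ℕ → A) (q : ℕ) :
    ∑ k ∈ Finset.range q, ∑ l ∈ Finset.range q, F k l =
      ∑ k ∈ Finset.range q, F k k + ∑ h ∈ Finset.range q, ∑ l ∈ Finset.range (q - (h + 1)),
        (F (l + (h + 1)) l + F l (l + (h + 1))) := by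
  induction q with
  | zero => simp
  | succ q ih =>
    have hgrow : ∑ h ∈ Finset.range (q + 1), ∑ l ∈ Finset.range (q + 1 - (h + 1)),
        (F (l + (h + 1)) l + F l (l + (h + 1))) =
        ∑ h ∈ Finset.range q, ∑ l ∈ Finset.range (q - (h + 1)),
          (F (l + (h + 1)) l + F l (l + (h + 1))) + ∑ l ∈ Finset.range q, (F q l + F l q) := by
      rw [Finset.sum_range_succ, Nat.sub_self, Finset.range_zero, Finset.sum_empty, add_zero,
        ← Finset.sum_range_reflect (fun l => F q l + F l q), ← Finset.sum_add_distrib]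
      refine Finset.sum_congr rfl fun h hh => ?_
      have hhq : h < q := Finset.mem_range.mp hh
      rw [show q + 1 - (h + 1) = q - (h + 1) + 1 by omega, Finset.sum_range_succ,
        show q - (h + 1) + (h + 1) = q by omega, show q - 1 - h = q - (h + 1) by omega]
    rw [hgrow, Finset.sum_range_succ (fun k => F k k), Finset.sum_range_succ]
    simp only [Finset.sum_range_succ, Finset.sum_add_distrib] at ih ⊢
    rw [ih]
    abel

theorem norm_sq_sum_range_le_sum_norm_correlation (u : ℕ → ℂ) (q : ℕ) :
    ‖∑ k ∈ Finset.range q, u k‖ ^ 2 ≤ ∑ k ∈ Finset.range q, ‖u k‖ ^ 2 +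
      2 * ∑ h ∈ Finset.range q,
        ‖∑ l ∈ Finset.range (q - (h + 1)), u (l + (h + 1)) * starRingEnd ℂ (u l)‖ := by
  have hsq : ‖∑ k ∈ Finset.range q, u k‖ ^ 2 =
      ‖∑ k ∈ Finset.range q, ∑ l ∈ Finset.range q, u k * starRingEnd ℂ (u l)‖ := by
    rw [← Finset.sum_mul_sum, norm_mul, ← map_sum, RCLike.norm_conj, sq]
  rw [hsq, sum_range_sum_range_eq_diagonals, Finset.mul_sum]
  refine (norm_add_le _ _).trans (add_le_add ?_ (norm_sum_le_of_le _ fun h _ => ?_))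
  · exact norm_sum_le_of_le _ fun k _ => by rw [norm_mul, RCLike.norm_conj, sq]
  · have hconj : ∑ l ∈ Finset.range (q - (h + 1)), u l * starRingEnd ℂ (u (l + (h + 1))) =
        starRingEnd ℂ (∑ l ∈ Finset.range (q - (h + 1)),
          u (l + (h + 1)) * starRingEnd ℂ (u l)) := by
      simp only [map_sum, map_mul, Complex.conj_conj, mul_comm]
    rw [Finset.sum_add_distrib, hconj, two_mul]
    exact (norm_add_le _ _).trans_eq (by rw [RCLike.norm_conj])

theorem norm_geom_sum_le {w : ℂ} (hw : ‖w‖ = 1) (hw1 : w ≠ 1) (M : ℕ) :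
    ‖∑ l ∈ Finset.range M, w ^ l‖ ≤ 2 * ‖w - 1‖⁻¹ := by
  rw [geom_sum_eq hw1, norm_div, div_eq_mul_inv]
  gcongr
  calc ‖w ^ M - 1‖ ≤ ‖w ^ M‖ + ‖(1 : ℂ)‖ := norm_sub_le _ _
    _ = 2 := by rw [norm_pow, hw, one_pow, norm_one, one_add_one_eq_two]

theorem four_mul_mul_one_sub_le_two_mul_sin {x : ℝ} (hx0 : 0 ≤ x) (hx1 : x ≤ 1) :
    4 * (x * (1 - x)) ≤ 2 * Real.sin (Real.pi * x) := by
  have hhalf : ∀ y : ℝ, 0 ≤ y → y ≤ 1 / 2 → 2 * y ≤ Real.sin (Real.pi * y) := fun y h0 h1 => by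
    have hjordan := Real.mul_le_sin (x := Real.pi * y) (by positivity)
      (by nlinarith [Real.pi_pos])
    rwa [← mul_assoc, div_mul_cancel₀ _ Real.pi_ne_zero] at hjordan
  rcases le_total x (1 / 2) with h | h
  · nlinarith [hhalf x hx0 h]
  · have hsymm : Real.sin (Real.pi * (1 - x)) = Real.sin (Real.pi * x) := by
      rw [mul_sub, mul_one, Real.sin_pi_sub]
    nlinarith [hhalf (1 - x) (by linarith) (by linarith)]

section StdAddChar

variable {q : ℕ} [NeZero q]

theorem inv_norm_stdAddChar_sub_one_le (j : ZMod q) :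
    ‖ZMod.stdAddChar j - 1‖⁻¹ ≤ q / 4 * ((j.val : ℝ)⁻¹ + ((q : ℝ) - j.val)⁻¹) := by
  have hval : (j.val : ℝ) < q := mod_cast j.val_lt
  have hq : (0 : ℝ) < q := j.val.cast_nonneg.trans_lt hval
  -- both sides rely on `0⁻¹ = 0` here
  rcases eq_or_ne j 0 with rfl | hj
  · simp only [AddChar.map_zero_eq_one, sub_self, norm_zero, inv_zero]
    exact mul_nonneg (by positivity)
      (add_nonneg (by positivity) (inv_nonneg.mpr (sub_nonneg.mpr hval.le)))
  have hpos : (0 : ℝ) < j.val := mod_cast Nat.pos_of_ne_zero ((ZMod.val_ne_zero j).mpr hj)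
  have hsub : (0 : ℝ) < q - j.val := sub_pos.mpr hval
  have hexp : ZMod.stdAddChar j = Complex.exp (I * ((2 * (Real.pi * (j.val / q)) : ℝ) : ℂ)) := by
    conv_lhs => rw [← ZMod.natCast_zmod_val j, ← Int.cast_natCast, ZMod.stdAddChar_coe]
    congr 1
    push_cast
    ring
  have hchord : 4 * (j.val / q * (1 - j.val / q)) ≤ ‖ZMod.stdAddChar j - 1‖ := by
    rw [hexp, Complex.norm_exp_I_mul_ofReal_sub_one, mul_div_cancel_left₀ _ two_ne_zero]
    exact (four_mul_mul_one_sub_le_two_mul_sin (by positivity)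
      ((div_le_one hq).mpr hval.le)).trans (Real.le_norm_self _)
  have hfrac : 0 < 1 - j.val / (q : ℝ) := sub_pos.mpr ((div_lt_one hq).mpr hval)
  calc ‖ZMod.stdAddChar j - 1‖⁻¹ ≤ (4 * (j.val / q * (1 - j.val / q)) : ℝ)⁻¹ := by gcongr
    _ = q / 4 * ((j.val : ℝ)⁻¹ + ((q : ℝ) - j.val)⁻¹) := by
      field_simp
      ring

theorem sum_range_natCast_eq_sum_zmod {A : Type*} [AddCommMonoid A] (F : ZMod q → A) :
    ∑ r ∈ Finset.range q, F r = ∑ j, F j :=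
  Finset.sum_nbij' (fun r => (r : ZMod q)) ZMod.val (fun _ _ => Finset.mem_univ _)
    (fun j _ => Finset.mem_range.mpr j.val_lt)
    (fun _ hr => ZMod.val_natCast_of_lt (Finset.mem_range.mp hr))
    (fun j _ => ZMod.natCast_zmod_val j) fun _ _ => rfl

theorem sum_inv_norm_stdAddChar_sub_one_le :
    ∑ j : ZMod q, ‖ZMod.stdAddChar j - 1‖⁻¹ ≤ q / 2 * (1 + Real.log q) := by
  have hharmonic : ∑ r ∈ Finset.range q, ((r : ℝ) + 1)⁻¹ ≤ 1 + Real.log q := by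
    have h := harmonic_le_one_add_log q
    simp only [harmonic, Rat.cast_sum, Rat.cast_inv, Rat.cast_add, Rat.cast_natCast,
      Rat.cast_one, Nat.cast_add, Nat.cast_one] at h
    exact h
  have hinv : ∑ r ∈ Finset.range q, (r : ℝ)⁻¹ ≤ 1 + Real.log q := by
    refine le_trans ?_ hharmonic
    calc ∑ r ∈ Finset.range q, (r : ℝ)⁻¹
        ≤ ∑ r ∈ Finset.range (q + 1), (r : ℝ)⁻¹ :=
          Finset.sum_le_sum_of_subset_of_nonneg (Finset.range_mono q.le_succ)
            fun r _ _ => by positivity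
      _ = ∑ r ∈ Finset.range q, ((r : ℝ) + 1)⁻¹ := by
          rw [Finset.sum_range_succ']
          simp only [Nat.cast_add, Nat.cast_one, Nat.cast_zero, inv_zero, add_zero]
  have hinv_sub : ∑ r ∈ Finset.range q, ((q : ℝ) - r)⁻¹ ≤ 1 + Real.log q := by
    refine le_of_eq_of_le ?_ hharmonic
    rw [← Finset.sum_range_reflect]
    refine Finset.sum_congr rfl fun r hr => ?_
    have hrq := Finset.mem_range.mp hr
    rw [Nat.sub_sub, Nat.cast_sub (by omega)]
    push_cast
    ring
  calc ∑ j : ZMod q, ‖ZMod.stdAddChar j - 1‖⁻¹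
      ≤ ∑ j : ZMod q, q / 4 * ((j.val : ℝ)⁻¹ + ((q : ℝ) - j.val)⁻¹) :=
        Finset.sum_le_sum fun j _ => inv_norm_stdAddChar_sub_one_le j
    _ = q / 4 * (∑ r ∈ Finset.range q, (r : ℝ)⁻¹ + ∑ r ∈ Finset.range q, ((q : ℝ) - r)⁻¹) := by
        rw [← sum_range_natCast_eq_sum_zmod, ← Finset.sum_add_distrib, Finset.mul_sum]
        exact Finset.sum_congr rfl fun r hr => by
          rw [ZMod.val_natCast_of_lt (Finset.mem_range.mp hr)]
    _ ≤ q / 4 * ((1 + Real.log q) + (1 + Real.log q)) := by gcongr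
    _ = q / 2 * (1 + Real.log q) := by ring

theorem sum_range_coprime_mul_succ {A : Type*} [AddCommMonoid A] {a : ℕ} (haq : a.Coprime q)
    (F : ZMod q → A) :
    ∑ h ∈ Finset.range q, F (a * (h + 1)) = ∑ j, F j := by
  rw [sum_range_natCast_eq_sum_zmod fun j : ZMod q => F (a * (j + 1))]
  exact Fintype.sum_equiv ((Equiv.addRight 1).trans (ZMod.unitOfCoprime a haq).mulLeft)
    _ _ fun _ => rfl

end StdAddChar

theorem norm_sq_quadratic_sum_le {a q : ℕ} (hq : q ≠ 0) (haq : a.Coprime q) (x : ℝ) :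
    ‖∑ k ∈ Finset.range q, Complex.exp (I * ((k * x + Real.pi * a / q * k ^ 2 : ℝ) : ℂ))‖ ^ 2 ≤
      3 * q * (1 + Real.log q) := by
  have : NeZero q := ⟨hq⟩
  set u : ℕ → ℂ := fun k => Complex.exp (I * ((k * x + Real.pi * a / q * k ^ 2 : ℝ) : ℂ))
  have hu : ∀ k, ‖u k‖ = 1 := fun k => Complex.norm_exp_I_mul_ofReal _
  have hcorr : ∀ h l : ℕ, u (l + h) * starRingEnd ℂ (u l) =
      u h * ZMod.stdAddChar (a * h : ZMod q) ^ l := fun h l => by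
    have hcast : (a * h : ZMod q) = ((a * h : ℤ) : ZMod q) := by push_cast; rfl
    rw [hcast, ZMod.stdAddChar_coe, ← Complex.exp_conj, map_mul, Complex.conj_I,
      Complex.conj_ofReal, ← Complex.exp_add, ← Complex.exp_nat_mul, ← Complex.exp_add]
    congr 1
    push_cast
    ring
  have hsum : ∀ h ∈ Finset.range q,
      ‖∑ l ∈ Finset.range (q - (h + 1)), u (l + (h + 1)) * starRingEnd ℂ (u l)‖ ≤
        2 * ‖ZMod.stdAddChar (a * (h + 1) : ZMod q) - 1‖⁻¹ := fun h hh => by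
    rcases (Nat.succ_le_of_lt (Finset.mem_range.mp hh)).eq_or_lt with hlast | hlt
    · rw [← Nat.succ_eq_add_one, hlast, Nat.sub_self, Finset.sum_range_zero, norm_zero]
      positivity
    have hne : (a * (h + 1) : ZMod q) ≠ 0 := fun h0 => by
      have hdvd : q ∣ a * (h + 1) := (ZMod.natCast_eq_zero_iff _ _).mp (mod_cast h0)
      exact Nat.not_dvd_of_pos_of_lt h.succ_pos hlt (haq.symm.dvd_of_dvd_mul_left hdvd)
    have hne1 : ZMod.stdAddChar (a * (h + 1) : ZMod q) ≠ 1 := fun h1 =>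
      hne (ZMod.injective_stdAddChar (h1.trans (AddChar.map_zero_eq_one _).symm))
    simp only [hcorr, ← Finset.mul_sum, norm_mul, hu, one_mul]
    exact_mod_cast norm_geom_sum_le (AddChar.norm_apply _ _) hne1 _
  calc ‖∑ k ∈ Finset.range q, u k‖ ^ 2
      ≤ ∑ k ∈ Finset.range q, ‖u k‖ ^ 2 + 2 * ∑ h ∈ Finset.range q,
          ‖∑ l ∈ Finset.range (q - (h + 1)), u (l + (h + 1)) * starRingEnd ℂ (u l)‖ :=
        norm_sq_sum_range_le_sum_norm_correlation u q
    _ ≤ q + 2 * (2 * (q / 2 * (1 + Real.log q))) := by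
        gcongr
        · simp [hu]
        refine (Finset.sum_le_sum hsum).trans ?_
        rw [← Finset.mul_sum,
          sum_range_coprime_mul_succ haq fun j => ‖ZMod.stdAddChar j - 1‖⁻¹]
        gcongr
        exact sum_inv_norm_stdAddChar_sub_one_le
    _ ≤ 3 * q * (1 + Real.log q) := by nlinarith [Real.log_natCast_nonneg q, q.cast_nonneg (α := ℝ)]

/-! ### Gaussians -/

section Gaussian

variable {ι : Type*} [Fintype ι]

theorem norm_sq_le_sqSum (ξ : ι → ℝ) : ‖ξ‖ ^ 2 ≤ sqSum ξ := by
  rw [← Real.le_sqrt (norm_nonneg _) (sqSum_nonneg ξ)]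
  refine (pi_norm_le_iff_of_nonneg (Real.sqrt_nonneg _)).mpr fun j => Real.le_sqrt_of_sq_le ?_
  rw [Real.norm_eq_abs, sq_abs]
  exact Finset.single_le_sum (f := fun j => ξ j ^ 2) (fun i _ => sq_nonneg _) (Finset.mem_univ j)

theorem sqSum_smul (c : ℝ) (ξ : ι → ℝ) : sqSum (c • ξ) = c ^ 2 * sqSum ξ := by
  simp [sqSum, mul_pow, Finset.mul_sum]

theorem hasTemperateGrowth_sqSum : Function.HasTemperateGrowth (sqSum : (ι → ℝ) → ℝ) := by
  unfold sqSum
  exact .sum fun j _ =>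
    (ContinuousLinearMap.proj (R := ℝ) (φ := fun _ : ι => ℝ) j).hasTemperateGrowth.pow 2

theorem hasTemperateGrowth_add_sqSum_rpow {c : ℝ} (hc : 0 < c) (r : ℝ) :
    Function.HasTemperateGrowth fun ξ : ι → ℝ => (((c + sqSum ξ) ^ r : ℝ) : ℂ) := by
  set L : (ι → ℝ) →L[ℝ] EuclideanSpace ℝ ι :=
    (Real.sqrt c)⁻¹ • ((EuclideanSpace.equiv ι ℝ).symm : (ι → ℝ) →L[ℝ] EuclideanSpace ℝ ι)
  have hnorm : ∀ ξ, ‖L ξ‖ ^ 2 = c⁻¹ * sqSum ξ := fun ξ => by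
    have hL : L ξ = (Real.sqrt c)⁻¹ • WithLp.toLp 2 ξ := rfl
    rw [hL, norm_smul, mul_pow, EuclideanSpace.norm_sq_eq, Real.norm_eq_abs, sq_abs, inv_pow,
      Real.sq_sqrt hc.le]
    simp [sqSum]
  have hscale : (fun ξ : ι → ℝ => (((c + sqSum ξ) ^ r : ℝ) : ℂ)) = Complex.ofReal ∘
      ((fun _ => c ^ r) * (fun x => (1 + ‖x‖ ^ 2) ^ r) ∘ L) := by
    funext ξ
    simp only [Function.comp_apply, Pi.mul_apply]
    rw [hnorm, ← Real.mul_rpow hc.le (by have := sqSum_nonneg ξ; positivity), mul_add, mul_one,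
      mul_inv_cancel_left₀ hc.ne']
  rw [hscale]
  exact Function.Complex.hasTemperateGrowth_ofReal.comp ((Function.HasTemperateGrowth.const _).mul
    ((Function.hasTemperateGrowth_one_add_norm_sq_rpow _ r).comp L.hasTemperateGrowth))

theorem contDiff_cexp_neg_mul_sqSum (b : ℂ) :
    ContDiff ℝ ∞ fun ξ : ι → ℝ => Complex.exp (-b * sqSum ξ) :=
  (contDiff_cexp_mul_ofReal (-b)).comp hasTemperateGrowth_sqSum.1

theorem exists_norm_iteratedFDeriv_cexp_neg_mul_sqSum_le {b : ℂ} (hb : 0 ≤ b.re) (j : ℕ) :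
    ∃ (k : ℕ) (C : ℝ), 0 ≤ C ∧ ∀ ξ : ι → ℝ,
      ‖iteratedFDeriv ℝ j (fun ξ : ι → ℝ => Complex.exp (-b * sqSum ξ)) ξ‖ ≤
        C * ((1 + ‖ξ‖) ^ k * Real.exp (-b.re * ‖ξ‖ ^ 2)) := by
  obtain ⟨k, C, hC0, hC⟩ := hasTemperateGrowth_sqSum (ι := ι).norm_iteratedFDeriv_le_uniform j
  refine ⟨k * j, j.factorial * (1 + ‖b‖) ^ j * (1 + C) ^ j, by positivity, fun ξ => ?_⟩
  have houter : ∀ i ≤ j, ‖iteratedFDeriv ℝ i (fun s : ℝ => Complex.exp (-b * s)) (sqSum ξ)‖ ≤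
      (1 + ‖b‖) ^ j * Real.exp (-b.re * ‖ξ‖ ^ 2) := fun i hi => by
    rw [norm_iteratedFDeriv_cexp_mul_ofReal, norm_neg, Complex.neg_re]
    have hpow : ‖b‖ ^ i ≤ (1 + ‖b‖) ^ j :=
      (pow_le_pow_left₀ (norm_nonneg b) (by linarith) i).trans
        (pow_le_pow_right₀ (by linarith [norm_nonneg b]) hi)
    have hexp : -b.re * sqSum ξ ≤ -b.re * ‖ξ‖ ^ 2 :=
      mul_le_mul_of_nonpos_left (norm_sq_le_sqSum ξ) (neg_nonpos.mpr hb)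
    gcongr
  have hinner : ∀ i, 1 ≤ i → i ≤ j →
      ‖iteratedFDeriv ℝ i (sqSum : (ι → ℝ) → ℝ) ξ‖ ≤ ((1 + C) * (1 + ‖ξ‖) ^ k) ^ i :=
    fun i hi1 hi => by
    have hone : 1 ≤ (1 + C) * (1 + ‖ξ‖) ^ k :=
      one_le_mul_of_one_le_of_one_le (by linarith)
        (one_le_pow₀ (by linarith [norm_nonneg ξ]))
    calc ‖iteratedFDeriv ℝ i (sqSum : (ι → ℝ) → ℝ) ξ‖ ≤ C * (1 + ‖ξ‖) ^ k := hC i hi ξ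
      _ ≤ (1 + C) * (1 + ‖ξ‖) ^ k := by gcongr; linarith
      _ ≤ ((1 + C) * (1 + ‖ξ‖) ^ k) ^ i := le_self_pow₀ hone (by omega)
  calc ‖iteratedFDeriv ℝ j (fun ξ : ι → ℝ => Complex.exp (-b * sqSum ξ)) ξ‖
      ≤ j.factorial * ((1 + ‖b‖) ^ j * Real.exp (-b.re * ‖ξ‖ ^ 2)) *
          ((1 + C) * (1 + ‖ξ‖) ^ k) ^ j :=
        norm_iteratedFDeriv_comp_le (contDiff_cexp_mul_ofReal (-b) (N := ∞))
          hasTemperateGrowth_sqSum.1 (mod_cast le_top) ξ houter hinner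
    _ = j.factorial * (1 + ‖b‖) ^ j * (1 + C) ^ j *
          ((1 + ‖ξ‖) ^ (k * j) * Real.exp (-b.re * ‖ξ‖ ^ 2)) := by
        rw [mul_pow, ← pow_mul]
        ring

theorem one_add_pow_mul_exp_le {β y : ℝ} (hβ : 0 < β) (hy : 0 ≤ y) (M : ℕ) :
    (1 + y) ^ M * Real.exp (-β * y ^ 2) ≤ M.factorial * Real.exp (1 + 1 / (4 * β)) := by
  have hpow := Real.pow_div_factorial_le_exp (1 + y) (by positivity) M
  rw [div_le_iff₀' (by positivity)] at hpow
  have hsquare : 1 + y + -β * y ^ 2 ≤ 1 + 1 / (4 * β) := by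
    have heq : 1 / (4 * β) - (y - β * y ^ 2) = β * (y - 1 / (2 * β)) ^ 2 := by field_simp; ring
    have hnonneg : 0 ≤ β * (y - 1 / (2 * β)) ^ 2 := by positivity
    linarith
  calc (1 + y) ^ M * Real.exp (-β * y ^ 2)
      ≤ M.factorial * Real.exp (1 + y) * Real.exp (-β * y ^ 2) := by gcongr
    _ = M.factorial * Real.exp (1 + y + -β * y ^ 2) := by rw [mul_assoc, ← Real.exp_add]
    _ ≤ M.factorial * Real.exp (1 + 1 / (4 * β)) := by gcongr

/-- The Gaussian `ξ ↦ exp (-b|ξ|²)`, `0 < Re b`, as a Schwartz function. -/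
noncomputable def gaussianSchwartz (ι : Type*) [Fintype ι] {b : ℂ} (hb : 0 < b.re) :
    𝓢(ι → ℝ, ℂ) where
  toFun ξ := Complex.exp (-b * sqSum ξ)
  smooth' := contDiff_cexp_neg_mul_sqSum b
  decay' l j := by
    obtain ⟨k, C, hC0, hC⟩ := exists_norm_iteratedFDeriv_cexp_neg_mul_sqSum_le (ι := ι) hb.le j
    refine ⟨C * ((l + k).factorial * Real.exp (1 + 1 / (4 * b.re))), fun ξ => ?_⟩
    calc ‖ξ‖ ^ l * ‖iteratedFDeriv ℝ j (fun ξ : ι → ℝ => Complex.exp (-b * sqSum ξ)) ξ‖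
        ≤ (1 + ‖ξ‖) ^ l * (C * ((1 + ‖ξ‖) ^ k * Real.exp (-b.re * ‖ξ‖ ^ 2))) := by
          gcongr
          · linarith
          · exact hC ξ
      _ = C * ((1 + ‖ξ‖) ^ (l + k) * Real.exp (-b.re * ‖ξ‖ ^ 2)) := by ring
      _ ≤ C * ((l + k).factorial * Real.exp (1 + 1 / (4 * b.re))) :=
          mul_le_mul_of_nonneg_left (one_add_pow_mul_exp_le hb (norm_nonneg ξ) _) hC0

theorem gaussianSchwartz_apply {b : ℂ} (hb : 0 < b.re) (ξ : ι → ℝ) :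
    gaussianSchwartz ι hb ξ = Complex.exp (-b * sqSum ξ) := rfl

theorem norm_gaussianSchwartz {b : ℂ} (hb : 0 < b.re) (ξ : ι → ℝ) :
    ‖gaussianSchwartz ι hb ξ‖ = Real.exp (-(b.re * sqSum ξ)) := by
  rw [gaussianSchwartz_apply, Complex.norm_exp, Complex.re_mul_ofReal, Complex.neg_re, neg_mul]

theorem norm_integral_gaussian_mul_planeWave {b : ℂ} (hb : 0 < b.re) (y : ι → ℝ) :
    ‖∫ ξ : ι → ℝ, Complex.exp (-b * sqSum ξ) * planeWave ξ y‖ =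
      (Real.pi / ‖b‖) ^ ((Fintype.card ι : ℝ) / 2) *
        Real.exp (-(b.re / (4 * Complex.normSq b) * sqSum y)) := by
  have hexp : ∀ ξ : ι → ℝ, Complex.exp (-b * sqSum ξ) * planeWave ξ y =
      Complex.exp (-b * ∑ j, (ξ j : ℂ) ^ 2 + ∑ j, (I * y j) * ξ j) := fun ξ => by
    rw [planeWave, ← Complex.exp_add, dotProduct, sqSum]
    push_cast
    rw [Finset.mul_sum _ _ I]
    congr 2
    exact Finset.sum_congr rfl fun j _ => by ring
  have hexponent : (∑ j, (I * (y j : ℂ)) ^ 2) / (4 * b) = ((-(sqSum y / 4) : ℝ) : ℂ) * b⁻¹ := by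
    simp only [mul_pow, Complex.I_sq, neg_one_mul, Finset.sum_neg_distrib, sqSum]
    push_cast
    rw [mul_comm 4 b, div_mul_eq_div_div, div_right_comm, neg_div, div_eq_mul_inv _ b]
  have hcard : (Fintype.card ι : ℂ) / 2 = (((Fintype.card ι : ℝ) / 2 : ℝ) : ℂ) := by
    push_cast
    rfl
  simp only [hexp]
  rw [GaussianFourier.integral_cexp_neg_mul_sum_add hb, hexponent, hcard, norm_mul,
    Complex.norm_cpow_real, norm_div, Complex.norm_real, Real.norm_of_nonneg Real.pi_nonneg,
    Complex.norm_exp, Complex.re_ofReal_mul, Complex.inv_re]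
  congr 2
  ring

end Gaussian

/-! ### The focusing data -/

section FocusWave

variable {m n : ℕ}

/-- The parameter `N⁻² - it` of the Gaussian `exp (-N⁻²|ξ|²) exp (it|ξ|²)`. -/
noncomputable def focusParam (N : ℕ) (t : ℝ) : ℂ := ⟨((N : ℝ) ^ 2)⁻¹, -t⟩

theorem focusParam_re_pos (N : ℕ) [NeZero N] (t : ℝ) : 0 < (focusParam N t).re :=
  inv_pos.mpr (by have := NeZero.pos N; positivity)

theorem normSq_focusParam (N : ℕ) (t : ℝ) :
    Complex.normSq (focusParam N t) = ((N : ℝ) ^ 2)⁻¹ ^ 2 + t ^ 2 := by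
  rw [Complex.normSq_apply, focusParam]
  ring

theorem cexp_neg_focusParam_mul_sqSum (N : ℕ) (t : ℝ) (ξ : Fin n → ℝ) :
    Complex.exp (-focusParam N t * sqSum ξ) =
      (Real.exp (-sqSum ((N : ℝ)⁻¹ • ξ)) : ℂ) * Complex.exp (I * ((t * sqSum ξ : ℝ) : ℂ)) := by
  rw [sqSum_smul, inv_pow, Complex.ofReal_exp, ← Complex.exp_add, focusParam,
    Complex.mk_eq_add_mul_I]
  congr 1
  push_cast
  ring

/-- The amplitude `(1 + |k|² + |ξ|²)^{-α/2} exp (-|ξ|²/N²)` of the focusing data. -/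
noncomputable def focusWeight (α : ℝ) (N : ℕ) (k : Fin m → ℤ) (ξ : Fin n → ℝ) : ℝ :=
  (1 + freqSq k ξ) ^ (-(α / 2)) * Real.exp (-sqSum ((N : ℝ)⁻¹ • ξ))

theorem focusWeight_nonneg (α : ℝ) (N : ℕ) (k : Fin m → ℤ) (ξ : Fin n → ℝ) :
    0 ≤ focusWeight α N k ξ := by
  have := freqSq_nonneg k ξ
  unfold focusWeight
  positivity

theorem rpow_mul_focusWeight (α : ℝ) (N : ℕ) (k : Fin m → ℤ) (ξ : Fin n → ℝ) :
    (1 + freqSq k ξ) ^ (α / 2) * focusWeight α N k ξ = Real.exp (-sqSum ((N : ℝ)⁻¹ • ξ)) := by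
  have hpos : 0 < 1 + freqSq k ξ := by linarith [freqSq_nonneg k ξ]
  rw [focusWeight, ← mul_assoc, ← Real.rpow_add hpos, add_neg_cancel, Real.rpow_zero, one_mul]

/-- The partial Fourier transform `ξ ↦ focusWeight α N k ξ * exp (it(|k|² + |ξ|²))` of the focusing
data at the lattice frequency `k`. -/
noncomputable def focusFreq (α t : ℝ) (N : ℕ) [NeZero N] (k : Fin m → ℤ) : 𝓢(Fin n → ℝ, ℂ) :=
  Complex.exp (I * ((t * sqSum (toRealVec k) : ℝ) : ℂ)) •
    SchwartzMap.smulLeftCLM ℂ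
      (fun ξ => (((1 + sqSum (toRealVec k) + sqSum ξ) ^ (-(α / 2)) : ℝ) : ℂ))
      (gaussianSchwartz (Fin n) (focusParam_re_pos N t))

theorem focusFreq_apply (α t : ℝ) (N : ℕ) [NeZero N] (k : Fin m → ℤ) (ξ : Fin n → ℝ) :
    focusFreq α t N k ξ =
      (focusWeight α N k ξ : ℂ) * Complex.exp (I * ((t * freqSq k ξ : ℝ) : ℂ)) := by
  have hpos : 0 < 1 + sqSum (toRealVec k) := by linarith [sqSum_nonneg (toRealVec k)]
  rw [focusFreq, smul_apply,
    SchwartzMap.smulLeftCLM_apply_apply (hasTemperateGrowth_add_sqSum_rpow hpos _),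
    gaussianSchwartz_apply, cexp_neg_focusParam_mul_sqSum, focusWeight, freqSq_eq, ← add_assoc,
    mul_add t, Complex.ofReal_add, mul_add I, Complex.exp_add, Complex.ofReal_mul (_ ^ _),
    smul_eq_mul, smul_eq_mul]
  ring

theorem integrable_focusWeight (α : ℝ) (N : ℕ) [NeZero N] (k : Fin m → ℤ) :
    Integrable fun ξ : Fin n → ℝ => focusWeight α N k ξ := by
  refine (focusFreq α 0 N k).integrable.norm.congr (.of_forall fun ξ => ?_)
  simp only [focusFreq_apply, norm_mul, Complex.norm_exp_I_mul_ofReal, mul_one,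
    Complex.norm_of_nonneg (focusWeight_nonneg α N k ξ)]

/-- Initial data on frequencies of size `N`, focusing at the origin at time `t`. -/
noncomputable def focusWave (m n : ℕ) (α t : ℝ) (N : ℕ) [NeZero N] : Cyl m n → ℂ :=
  waveSum (latticeCube m N) (focusFreq α t N)

theorem schrodinger_focusWave (α t₀ t : ℝ) (N : ℕ) [NeZero N] (z : Cyl m n) :
    schrodinger t (focusWave m n α t₀ N) z = ∑ k ∈ latticeCube m N, ∫ ξ,
      (focusWeight α N k ξ : ℂ) *
        Complex.exp (I * ((cylPhase k ξ z - (t - t₀) * freqSq k ξ : ℝ) : ℂ)) := by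
  rw [schrodinger, focusWave, cylMultiplier_waveSum]
  refine Finset.sum_congr rfl fun k _ => integral_congr_ae (.of_forall fun ξ => ?_)
  simp only [focusFreq_apply]
  rw [mul_left_comm, mul_assoc, ← Complex.exp_add, ← Complex.exp_add]
  congr 2
  push_cast
  ring

theorem sum_latticeCube_prod {R : Type*} [CommSemiring R] (d N : ℕ) (u : Fin d → ℤ → R) :
    ∑ k ∈ latticeCube d N, ∏ i, u i (k i) = ∏ i, ∑ j ∈ Finset.range N, u i j := by
  have hrange (v : ℤ → R) : ∑ j ∈ Finset.range N, v j = ∑ j ∈ Finset.Ico 0 (N : ℤ), v j := by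
    simp [Int.Ico_eq_finset_map]
  simp only [hrange, Finset.prod_univ_sum, latticeCube]

theorem planeWave_mul_cexp_sqSum_eq_prod (k : Fin m → ℤ) (t : ℝ) (x : Fin m → ℝ) :
    planeWave (toRealVec k) x * Complex.exp (I * ((t * sqSum (toRealVec k) : ℝ) : ℂ)) =
      ∏ i, Complex.exp (I * ((k i * x i + t * (k i : ℝ) ^ 2 : ℝ) : ℂ)) := by
  rw [planeWave, ← Complex.exp_add, ← mul_add, ← Complex.ofReal_add, ← Complex.exp_sum,
    ← Finset.mul_sum, ← Complex.ofReal_sum, Finset.sum_add_distrib, ← Finset.mul_sum]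
  rfl

theorem rpow_mul_focusFreq_mul_cexp (α t : ℝ) (N : ℕ) [NeZero N] (k : Fin m → ℤ) (ξ : Fin n → ℝ)
    (z : Cyl m n) :
    (((1 + freqSq k ξ) ^ (α / 2) : ℝ) : ℂ) * focusFreq α t N k ξ *
        Complex.exp (I * (cylPhase k ξ z : ℂ)) =
      (∏ i, Complex.exp (I * ((k i * z.1 i + t * (k i : ℝ) ^ 2 : ℝ) : ℂ))) *
        (Complex.exp (-focusParam N t * sqSum ξ) * planeWave ξ z.2) := by
  rw [focusFreq_apply, ← mul_assoc, ← Complex.ofReal_mul, rpow_mul_focusWeight, cexp_cylPhase,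
    ← planeWave_mul_cexp_sqSum_eq_prod, cexp_neg_focusParam_mul_sqSum, freqSq_eq, mul_add,
    Complex.ofReal_add, mul_add, Complex.exp_add]
  ring

theorem besselPotential_focusWave (α t : ℝ) (N : ℕ) [NeZero N] (z : Cyl m n) :
    besselPotential α (focusWave m n α t N) z =
      (∏ i, ∑ j ∈ Finset.range N, Complex.exp (I * ((j * z.1 i + t * j ^ 2 : ℝ) : ℂ))) *
        ∫ ξ, Complex.exp (-focusParam N t * sqSum ξ) * planeWave ξ z.2 := by
  rw [besselPotential, focusWave, cylMultiplier_waveSum]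
  simp only [rpow_mul_focusFreq_mul_cexp, integral_const_mul, ← Finset.sum_mul]
  rw [sum_latticeCube_prod m N
    fun i j => Complex.exp (I * ((j * z.1 i + t * (j : ℝ) ^ 2 : ℝ) : ℂ))]
  simp only [Int.cast_natCast]

/-- The profile `exp (-|y|²/8)`, which after dilation by `N` dominates the Bessel potential of the
focusing data. -/
noncomputable def gaussProfile (n : ℕ) : 𝓢(Fin n → ℝ, ℂ) :=
  gaussianSchwartz (Fin n) (b := (8 : ℂ)⁻¹) (by norm_num)

theorem norm_integral_focusParam_le {N : ℕ} [NeZero N] {t : ℝ} (ht : Real.pi / 5 ≤ t)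
    (ht1 : t ≤ 1) (y : Fin n → ℝ) :
    ‖∫ ξ, Complex.exp (-focusParam N t * sqSum ξ) * planeWave ξ y‖ ≤
      5 ^ n * ‖gaussProfile n ((N : ℝ)⁻¹ • y)‖ := by
  have ht0 : 0 < t := (by positivity : 0 < Real.pi / 5).trans_le ht
  have hε := focusParam_re_pos N t
  set ε := (focusParam N t).re
  have hε1 : ε ≤ 1 := inv_le_one_of_one_le₀ (one_le_pow₀ (Nat.one_le_cast.mpr NeZero.one_le))
  rw [norm_integral_gaussian_mul_planeWave hε, Fintype.card_fin]
  have hamplitude : (Real.pi / ‖focusParam N t‖) ^ ((n : ℝ) / 2) ≤ 5 ^ n := by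
    have hnorm : t ≤ ‖focusParam N t‖ := by
      simpa [focusParam, abs_of_pos ht0] using Complex.abs_im_le_norm (focusParam N t)
    have hbase : Real.pi / ‖focusParam N t‖ ≤ 5 := by
      rw [div_le_iff₀ (ht0.trans_le hnorm)]
      linarith
    calc (Real.pi / ‖focusParam N t‖) ^ ((n : ℝ) / 2) ≤ 5 ^ ((n : ℝ) / 2) := by gcongr
      _ ≤ 5 ^ (n : ℝ) :=
        Real.rpow_le_rpow_of_exponent_le (by norm_num) (half_le_self n.cast_nonneg)
      _ = 5 ^ n := Real.rpow_natCast _ _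
  have hdecay : Real.exp (-(ε / (4 * Complex.normSq (focusParam N t)) * sqSum y)) ≤
      ‖gaussProfile n ((N : ℝ)⁻¹ • y)‖ := by
    have hnormSq : Complex.normSq (focusParam N t) = ε ^ 2 + t ^ 2 := normSq_focusParam N t
    have hhalf : ε / 8 ≤ ε / (4 * Complex.normSq (focusParam N t)) := by
      rw [hnormSq]
      gcongr
      nlinarith
    have hscaled : sqSum ((N : ℝ)⁻¹ • y) = ε * sqSum y := by rw [sqSum_smul, inv_pow]; rfl
    rw [gaussProfile, norm_gaussianSchwartz, hscaled]
    refine Real.exp_le_exp.mpr (neg_le_neg ?_)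
    calc ((8 : ℂ)⁻¹).re * (ε * sqSum y) = ε / 8 * sqSum y := by norm_num; ring
      _ ≤ _ := mul_le_mul_of_nonneg_right hhalf (sqSum_nonneg y)
  exact mul_le_mul hamplitude hdecay (Real.exp_nonneg _) (by positivity)

theorem norm_besselPotential_focusWave_le {a N : ℕ} [NeZero N] (haN : a.Coprime N)
    (ht : Real.pi * a / N ∈ Set.Icc (Real.pi / 5) 1) (α : ℝ) (z : Cyl m n) :
    ‖besselPotential α (focusWave m n α (Real.pi * a / N) N) z‖ ≤
      Real.sqrt (3 * N * (1 + Real.log N)) ^ m * 5 ^ n * ‖gaussProfile n ((N : ℝ)⁻¹ • z.2)‖ := by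
  rw [besselPotential_focusWave, norm_mul, norm_prod, mul_assoc]
  refine mul_le_mul ?_ (norm_integral_focusParam_le ht.1 ht.2 z.2) (norm_nonneg _) (by positivity)
  calc ∏ i, ‖∑ j ∈ Finset.range N,
        Complex.exp (I * ((j * z.1 i + Real.pi * a / N * j ^ 2 : ℝ) : ℂ))‖
      ≤ ∏ _i : Fin m, Real.sqrt (3 * N * (1 + Real.log N)) :=
        Finset.prod_le_prod (fun _ _ => norm_nonneg _) fun i _ =>
          Real.le_sqrt_of_sq_le (norm_sq_quadratic_sum_le (NeZero.ne N) haN (z.1 i))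
    _ = Real.sqrt (3 * N * (1 + Real.log N)) ^ m := by
        rw [Finset.prod_const, Finset.card_univ, Fintype.card_fin]

theorem eLpNorm_snd_comp_inv_smul (h : 𝓢(Fin n → ℝ, ℂ)) (p : ℝ≥0∞) {R : ℝ} (hR : 0 < R) :
    eLpNorm (fun z : Cyl m n => h (R⁻¹ • z.2)) p (cylMeasure m n) =
      ENNReal.ofReal (R ^ n) ^ (p⁻¹).toReal *
        eLpNorm (fun z : Cyl m n => h z.2) p (cylMeasure m n) := by
  have hmap : Measure.map (Prod.map id (fun y => R⁻¹ • y)) (cylMeasure m n) =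
      ENNReal.ofReal (R ^ n) • cylMeasure m n := by
    rw [cylMeasure, ← Measure.map_prod_map _ _ measurable_id (measurable_const_smul R⁻¹),
      Measure.map_id, Measure.map_addHaar_smul _ (inv_ne_zero hR.ne'), Module.finrank_fin_fun,
      inv_pow, inv_inv, abs_of_pos (by positivity), Measure.prod_smul_right]
  have hscale := eLpNorm_map_measure (p := p) (g := fun z : Cyl m n => h z.2)
    (h.continuous.comp continuous_snd).aestronglyMeasurable
    (μ := cylMeasure m n) (measurable_id.prodMap (measurable_const_smul R⁻¹)).aemeasurable
  rw [hmap, eLpNorm_smul_measure_of_ne_zero (ENNReal.ofReal_pos.mpr (by positivity)).ne',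
    smul_eq_mul, one_div] at hscale
  exact hscale.symm

theorem sobolevNorm_focusWave_le {a N : ℕ} [NeZero N] (haN : a.Coprime N)
    (ht : Real.pi * a / N ∈ Set.Icc (Real.pi / 5) 1) (α : ℝ) (p : ℝ≥0∞) :
    sobolevNorm α p (focusWave m n α (Real.pi * a / N) N) ≤
      ENNReal.ofReal (Real.sqrt (3 * N * (1 + Real.log N)) ^ m * 5 ^ n) *
        (ENNReal.ofReal ((N : ℝ) ^ n) ^ (p⁻¹).toReal *
          eLpNorm (fun z : Cyl m n => gaussProfile n z.2) p (cylMeasure m n)) := by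
  rw [← eLpNorm_snd_comp_inv_smul (gaussProfile n) p (Nat.cast_pos.mpr (NeZero.pos N))]
  exact eLpNorm_le_mul_eLpNorm_of_ae_le_mul
    (.of_forall fun z => norm_besselPotential_focusWave_le haN ht α z) p

end FocusWave

theorem one_sub_abs_le_cos (θ : ℝ) : 1 - |θ| ≤ Real.cos θ := by
  rcases le_total |θ| 2 with h | h
  · have hcos := Real.one_sub_sq_div_two_le_cos (x := θ)
    have hsq : θ ^ 2 = |θ| ^ 2 := (sq_abs θ).symm
    nlinarith [abs_nonneg θ]
  · linarith [Real.neg_one_le_cos θ]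

theorem abs_dotProduct_le_card_add_sqSum {ι : Type*} [Fintype ι] {η w : ι → ℝ} {δ : ℝ}
    (hw : ∀ j, |w j| ≤ δ) : |η ⬝ᵥ w| ≤ δ * (Fintype.card ι + sqSum η) := by
  have hterm (j : ι) : |η j * w j| ≤ δ * (1 + η j ^ 2) := by
    have hη : |η j| ≤ 1 + η j ^ 2 := by nlinarith [sq_abs (η j), sq_nonneg (|η j| - 1)]
    rw [abs_mul, mul_comm]
    exact mul_le_mul (hw j) hη (abs_nonneg _) ((abs_nonneg _).trans (hw j))
  calc |η ⬝ᵥ w| ≤ ∑ j, |η j * w j| := Finset.abs_sum_le_sum_abs _ _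
    _ ≤ ∑ j, δ * (1 + η j ^ 2) := Finset.sum_le_sum fun j _ => hterm j
    _ = δ * (Fintype.card ι + sqSum η) := by
        rw [← Finset.mul_sum, Finset.sum_add_distrib]
        simp [sqSum]

theorem natCast_rpow_neg (N : ℕ) (α : ℝ) : (N : ℝ) ^ (-α) = ((N : ℝ) ^ 2) ^ (-(α / 2)) := by
  rw [← Real.rpow_natCast_mul N.cast_nonneg]
  congr 1
  push_cast
  ring

section Focusing

variable {m n N : ℕ} [NeZero N]

theorem sqSum_eq_sq_mul_sqSum_inv_smul (ξ : Fin n → ℝ) :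
    sqSum ξ = (N : ℝ) ^ 2 * sqSum ((N : ℝ)⁻¹ • ξ) := by
  rw [← sqSum_smul, smul_inv_smul₀ (NeZero.ne _)]

theorem freqSq_le_of_mem_latticeCube {k : Fin m → ℤ} (hk : k ∈ latticeCube m N) (ξ : Fin n → ℝ) :
    freqSq k ξ ≤ (N : ℝ) ^ 2 * (m + sqSum ((N : ℝ)⁻¹ • ξ)) := by
  have hk' := sqSum_le fun i => (abs_toRealVec_le_of_mem_latticeCube hk i).trans (sub_one_lt _).le
  rw [Fintype.card_fin] at hk'
  rw [freqSq_eq, sqSum_eq_sq_mul_sqSum_inv_smul (N := N) ξ]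
  linarith

theorem abs_focus_phase_le {k : Fin m → ℤ} (hk : k ∈ latticeCube m N) (ξ : Fin n → ℝ) {δ s : ℝ}
    (hs : s ∈ Set.Icc 0 (δ / N ^ 2)) {z : Cyl m n} (hz : z ∈ cylCube m n (δ / N)) :
    |cylPhase k ξ z - s * freqSq k ξ| ≤
      2 * (m + n + 1) * δ * (1 + sqSum ((N : ℝ)⁻¹ • ξ)) := by
  have hN : (0 : ℝ) < N := Nat.cast_pos.mpr (NeZero.pos N)
  have hδ : 0 ≤ δ := by
    have := hs.1.trans hs.2
    rwa [le_div_iff₀ (by positivity), zero_mul] at this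
  obtain ⟨hx, hy⟩ := abs_le_of_mem_cylCube hz
  set R := sqSum ((N : ℝ)⁻¹ • ξ)
  have hR : 0 ≤ R := sqSum_nonneg _
  have htorus : |toRealVec k ⬝ᵥ z.1| ≤ m * δ := by
    refine (abs_dotProduct_le (fun i => (abs_toRealVec_le_of_mem_latticeCube hk i).trans
      (sub_one_lt _).le) hx).trans_eq ?_
    rw [Fintype.card_fin, mul_div_cancel₀ _ hN.ne']
  have heuclid : |ξ ⬝ᵥ z.2| ≤ δ * (n + R) := by
    have hdilate : ξ ⬝ᵥ z.2 = ((N : ℝ)⁻¹ • ξ) ⬝ᵥ ((N : ℝ) • z.2) := by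
      rw [smul_dotProduct, dotProduct_smul, smul_smul, inv_mul_cancel₀ hN.ne', one_smul]
    rw [hdilate]
    refine (abs_dotProduct_le_card_add_sqSum (δ := δ) fun j => ?_).trans_eq
      (by rw [Fintype.card_fin])
    rw [Pi.smul_apply, smul_eq_mul, abs_mul, abs_of_pos hN, ← le_div_iff₀' hN]
    exact hy j
  have htime : |s * freqSq k ξ| ≤ δ * (m + R) := by
    rw [abs_of_nonneg (mul_nonneg hs.1 (freqSq_nonneg k ξ))]
    calc s * freqSq k ξ ≤ δ / N ^ 2 * (N ^ 2 * (m + R)) :=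
          mul_le_mul hs.2 (freqSq_le_of_mem_latticeCube hk ξ) (freqSq_nonneg k ξ) (by positivity)
      _ = δ * (m + R) := by field_simp
  calc |cylPhase k ξ z - s * freqSq k ξ|
      ≤ |toRealVec k ⬝ᵥ z.1| + |ξ ⬝ᵥ z.2| + |s * freqSq k ξ| :=
        (abs_sub _ _).trans (add_le_add_left (abs_add_le _ _) _)
    _ ≤ m * δ + δ * (n + R) + δ * (m + R) := by gcongr
    _ ≤ 2 * (m + n + 1) * δ * (1 + R) := by
        have : 0 ≤ δ * (n + 2 + 2 * (m + n) * R) := by positivity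
        linarith

theorem le_focusWeight {α : ℝ} (hα : 0 ≤ α) {k : Fin m → ℤ} (hk : k ∈ latticeCube m N)
    {ξ : Fin n → ℝ} (hξ : sqSum ((N : ℝ)⁻¹ • ξ) ≤ 1) :
    (N : ℝ) ^ (-α) * (((m : ℝ) + 2) ^ (-(α / 2)) * Real.exp (-1)) ≤ focusWeight α N k ξ := by
  have hN : (1 : ℝ) ≤ N := Nat.one_le_cast.mpr NeZero.one_le
  have hfreq := freqSq_nonneg k ξ
  have hle : 1 + freqSq k ξ ≤ (N : ℝ) ^ 2 * (m + 2) := by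
    have hsq : (N : ℝ) ^ 2 * sqSum ((N : ℝ)⁻¹ • ξ) ≤ (N : ℝ) ^ 2 :=
      mul_le_of_le_one_right (by positivity) hξ
    linarith [freqSq_le_of_mem_latticeCube hk ξ, one_le_pow₀ hN (n := 2)]
  rw [natCast_rpow_neg, ← mul_assoc, ← Real.mul_rpow (by positivity) (by positivity), focusWeight]
  exact mul_le_mul (Real.rpow_le_rpow_of_nonpos (by positivity) hle (by linarith))
    (Real.exp_le_exp.mpr (neg_le_neg hξ)) (Real.exp_nonneg _) (by positivity)

theorem focusWeight_le {α : ℝ} (hα : 0 ≤ α) (k : Fin m → ℤ) {ξ : Fin n → ℝ}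
    (hξ : 1 ≤ sqSum ((N : ℝ)⁻¹ • ξ)) :
    focusWeight α N k ξ ≤ (N : ℝ) ^ (-α) * Real.exp (-sqSum ((N : ℝ)⁻¹ • ξ)) := by
  have hN : (0 : ℝ) < N := Nat.cast_pos.mpr (NeZero.pos N)
  have hle : (N : ℝ) ^ 2 ≤ 1 + freqSq k ξ := by
    have hsq : (N : ℝ) ^ 2 ≤ (N : ℝ) ^ 2 * sqSum ((N : ℝ)⁻¹ • ξ) :=
      le_mul_of_one_le_right (by positivity) hξ
    rw [freqSq_eq, sqSum_eq_sq_mul_sqSum_inv_smul (N := N) ξ]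
    linarith [sqSum_nonneg (toRealVec k)]
  rw [natCast_rpow_neg, focusWeight]
  exact mul_le_mul_of_nonneg_right
    (Real.rpow_le_rpow_of_nonpos (by positivity) hle (by linarith)) (Real.exp_nonneg _)

end Focusing

section FocusMinorant

variable {m n : ℕ}

/-- The cube `[0, 1/(n+1)]ⁿ`, which lies in the Euclidean unit ball. -/
def focusCore (n : ℕ) : Set (Fin n → ℝ) := Set.Icc 0 fun _ => ((n : ℝ) + 1)⁻¹

theorem sqSum_le_one_of_mem_focusCore {η : Fin n → ℝ} (hη : η ∈ focusCore n) : sqSum η ≤ 1 := by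
  have hle := sqSum_le fun j => (abs_of_nonneg (hη.1 j)).trans_le (hη.2 j)
  refine hle.trans ?_
  rw [Fintype.card_fin, inv_pow, ← div_eq_mul_inv]
  exact div_le_one_of_le₀ (by nlinarith [n.cast_nonneg (α := ℝ)]) (by positivity)

/-- A minorant, in the rescaled frequency `η = ξ/N`, of the real part of the integrand of the
evolved focusing data: `κ` bounds the amplitude from below on `focusCore n`, where the phase is
small, and the second term absorbs the uncontrolled phases outside the unit ball. -/
noncomputable def focusMinorant (n : ℕ) (κ ε : ℝ) (η : Fin n → ℝ) : ℝ :=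
  (focusCore n).indicator (fun _ => κ) η - 2 * ε * Real.exp (-(1 / 2 * sqSum η))

theorem integrable_exp_neg_half_sqSum (n : ℕ) :
    Integrable fun η : Fin n → ℝ => Real.exp (-(1 / 2 * sqSum η)) := by
  have hre : ((1 / 2 : ℝ) : ℂ).re = 1 / 2 := Complex.ofReal_re _
  refine (gaussianSchwartz (Fin n) (b := (1 / 2 : ℝ)) (by norm_num)).integrable.norm.congr
    (.of_forall fun η => ?_)
  simp only [norm_gaussianSchwartz, hre]

theorem integrable_indicator_focusCore (n : ℕ) (κ : ℝ) :
    Integrable ((focusCore n).indicator fun _ => κ) :=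
  (integrable_indicator_iff measurableSet_Icc).mpr
    (integrableOn_const isCompact_Icc.measure_lt_top.ne)

theorem integrable_focusMinorant (n : ℕ) (κ ε : ℝ) : Integrable (focusMinorant n κ ε) :=
  (integrable_indicator_focusCore n κ).sub ((integrable_exp_neg_half_sqSum n).const_mul _)

theorem integral_focusMinorant (n : ℕ) (κ ε : ℝ) :
    ∫ η, focusMinorant n κ ε η =
      ((n : ℝ) + 1)⁻¹ ^ n * κ - 2 * ε * ∫ η : Fin n → ℝ, Real.exp (-(1 / 2 * sqSum η)) := by
  simp only [focusMinorant]
  rw [integral_sub (integrable_indicator_focusCore n κ)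
    ((integrable_exp_neg_half_sqSum n).const_mul _), integral_const_mul, focusCore,
    integral_indicator_const _ measurableSet_Icc, measureReal_def, Real.volume_Icc_pi_toReal]
  · simp
  · exact fun _ => by positivity

theorem exists_integral_focusMinorant_pos (n : ℕ) {κ : ℝ} (hκ : 0 < κ) :
    ∃ ε > 0, ε ≤ 1 / 4 ∧ 0 < ∫ η, focusMinorant n κ ε η := by
  simp only [integral_focusMinorant]
  set A := ((n : ℝ) + 1)⁻¹ ^ n * κ
  set B := ∫ η : Fin n → ℝ, Real.exp (-(1 / 2 * sqSum η))
  have hA : 0 < A := by positivity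
  have hB : 0 ≤ B := integral_nonneg fun _ => Real.exp_nonneg _
  refine ⟨min (1 / 4) (A / (2 * (B + 1))), by positivity, min_le_left _ _, sub_pos.mpr ?_⟩
  calc 2 * min (1 / 4) (A / (2 * (B + 1))) * B ≤ 2 * (A / (2 * (B + 1))) * B := by
        gcongr
        exact min_le_right _ _
    _ = A * (B / (B + 1)) := by field_simp
    _ < A := mul_lt_of_lt_one_right hA ((div_lt_one (by positivity)).mpr (lt_add_one B))

theorem one_add_mul_exp_neg_le (R : ℝ) :
    (1 + R) * Real.exp (-R) ≤ 2 * Real.exp (-(1 / 2 * R)) := by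
  have hexp : Real.exp (-(1 / 2 * R)) = Real.exp (R / 2) * Real.exp (-R) := by
    rw [← Real.exp_add]
    ring_nf
  rw [hexp, ← mul_assoc]
  gcongr
  linarith [Real.add_one_le_exp (R / 2)]

theorem mul_focusMinorant_le {N : ℕ} [NeZero N] {k : Fin m → ℤ} (hk : k ∈ latticeCube m N)
    (ξ : Fin n → ℝ) {α ε θ : ℝ} (hα : 0 ≤ α) (hε0 : 0 ≤ ε) (hε : ε ≤ 1 / 4)
    (hθ : |θ| ≤ ε * (1 + sqSum ((N : ℝ)⁻¹ • ξ))) :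
    (N : ℝ) ^ (-α) * focusMinorant n (((m : ℝ) + 2) ^ (-(α / 2)) * Real.exp (-1) / 2) ε
      ((N : ℝ)⁻¹ • ξ) ≤ focusWeight α N k ξ * Real.cos θ := by
  set κ := ((m : ℝ) + 2) ^ (-(α / 2)) * Real.exp (-1)
  have hweight := focusWeight_nonneg α N k ξ
  have hcos := one_sub_abs_le_cos θ
  rcases le_or_gt (sqSum ((N : ℝ)⁻¹ • ξ)) 1 with hξ | hξ
  · have hcos_half : 1 / 2 ≤ Real.cos θ := by nlinarith
    have hminorant : focusMinorant n (κ / 2) ε ((N : ℝ)⁻¹ • ξ) ≤ κ * (1 / 2) := by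
      have hind := Set.indicator_le_self' (s := focusCore n) (f := fun _ => κ / 2)
        (fun _ _ => by positivity) ((N : ℝ)⁻¹ • ξ)
      have htail : 0 ≤ 2 * ε * Real.exp (-(1 / 2 * sqSum ((N : ℝ)⁻¹ • ξ))) := by positivity
      rw [focusMinorant]
      linarith
    calc (N : ℝ) ^ (-α) * focusMinorant n (κ / 2) ε ((N : ℝ)⁻¹ • ξ)
        ≤ (N : ℝ) ^ (-α) * κ * (1 / 2) := by
          rw [mul_assoc]
          gcongr
      _ ≤ focusWeight α N k ξ * Real.cos θ :=
          mul_le_mul (le_focusWeight hα hk hξ) hcos_half (by norm_num) hweight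
  · have hcore : (N : ℝ)⁻¹ • ξ ∉ focusCore n := fun h =>
      (sqSum_le_one_of_mem_focusCore h).not_gt hξ
    rw [focusMinorant, Set.indicator_of_notMem hcore, zero_sub]
    set R := sqSum ((N : ℝ)⁻¹ • ξ)
    calc (N : ℝ) ^ (-α) * -(2 * ε * Real.exp (-(1 / 2 * R)))
        = -((N : ℝ) ^ (-α) * (ε * (2 * Real.exp (-(1 / 2 * R))))) := by ring
      _ ≤ -((N : ℝ) ^ (-α) * (ε * ((1 + R) * Real.exp (-R)))) := by
          gcongr -(_ * (_ * ?_))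
          exact one_add_mul_exp_neg_le R
      _ = -((N : ℝ) ^ (-α) * Real.exp (-R) * (ε * (1 + R))) := by ring
      _ ≤ -(focusWeight α N k ξ * (ε * (1 + R))) := by
          gcongr
          exact focusWeight_le hα k hξ.le
      _ ≤ focusWeight α N k ξ * Real.cos θ := by
          rw [← mul_neg]
          gcongr
          linarith

end FocusMinorant

/-! ### The Sobolev exponent -/

section SobolevExponent

variable {m n : ℕ}

theorem le_integral_focusWeight_mul_cos {N : ℕ} [NeZero N] {k : Fin m → ℤ}
    (hk : k ∈ latticeCube m N) {α ε : ℝ} (hα : 0 ≤ α) (hε0 : 0 ≤ ε) (hε : ε ≤ 1 / 4)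
    {θ : (Fin n → ℝ) → ℝ} (hmeas : Measurable θ)
    (hθ : ∀ ξ, |θ ξ| ≤ ε * (1 + sqSum ((N : ℝ)⁻¹ • ξ))) :
    (N : ℝ) ^ (-α) * ((N : ℝ) ^ n *
      ∫ η, focusMinorant n (((m : ℝ) + 2) ^ (-(α / 2)) * Real.exp (-1) / 2) ε η) ≤
        ∫ ξ, focusWeight α N k ξ * Real.cos (θ ξ) := by
  set κ := ((m : ℝ) + 2) ^ (-(α / 2)) * Real.exp (-1) / 2
  have hminorant : Integrable fun ξ : Fin n → ℝ =>
      (N : ℝ) ^ (-α) * focusMinorant n κ ε ((N : ℝ)⁻¹ • ξ) :=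
    ((integrable_focusMinorant n κ ε).comp_smul (inv_ne_zero (NeZero.ne _))).const_mul _
  have hintegrand : Integrable fun ξ => focusWeight α N k ξ * Real.cos (θ ξ) :=
    (integrable_focusWeight α N k).mul_bdd (c := 1)
      (Real.measurable_cos.comp hmeas).aestronglyMeasurable
      (.of_forall fun ξ => Real.abs_cos_le_one _)
  calc (N : ℝ) ^ (-α) * ((N : ℝ) ^ n * ∫ η, focusMinorant n κ ε η)
      = ∫ ξ, (N : ℝ) ^ (-α) * focusMinorant n κ ε ((N : ℝ)⁻¹ • ξ) := by
        rw [integral_const_mul, Measure.integral_comp_inv_smul, Module.finrank_fin_fun,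
          abs_of_nonneg (by positivity), smul_eq_mul]
    _ ≤ ∫ ξ, focusWeight α N k ξ * Real.cos (θ ξ) :=
        integral_mono hminorant hintegrand fun ξ => mul_focusMinorant_le hk ξ hα hε0 hε (hθ ξ)

theorem exists_le_norm_schrodinger_focusWave (m n : ℕ) {α : ℝ} (hα : 0 ≤ α) :
    ∃ c > 0, ∃ δ > 0, δ ≤ 1 / 8 ∧ ∀ (N : ℕ) [NeZero N] (t₀ : ℝ), ∀ z ∈ cylCube m n (δ / N),
      ∀ t ∈ Set.Icc t₀ (t₀ + δ / N ^ 2),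
        c * (N : ℝ) ^ ((m : ℝ) + n - α) ≤ ‖schrodinger t (focusWave m n α t₀ N) z‖ := by
  set κ := ((m : ℝ) + 2) ^ (-(α / 2)) * Real.exp (-1) / 2
  obtain ⟨ε, hε0, hε, hpos⟩ := exists_integral_focusMinorant_pos n (show 0 < κ by positivity)
  have : (1 : ℝ) ≤ m + n + 1 := le_add_of_nonneg_left (by positivity)
  refine ⟨_, hpos, ε / (2 * (m + n + 1)), by positivity, ?_, fun N _ t₀ z hz t ht => ?_⟩
  · rw [div_le_iff₀ (by positivity)]
    linarith
  have hN : (0 : ℝ) < N := Nat.cast_pos.mpr (NeZero.pos N)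
  have hmeas (k : Fin m → ℤ) : Measurable fun ξ => cylPhase k ξ z - (t - t₀) * freqSq k ξ := by
    unfold cylPhase freqSq
    fun_prop
  have hphase (k) (hk : k ∈ latticeCube m N) (ξ : Fin n → ℝ) :
      |cylPhase k ξ z - (t - t₀) * freqSq k ξ - 0| ≤ ε * (1 + sqSum ((N : ℝ)⁻¹ • ξ)) := by
    have h := abs_focus_phase_le hk ξ ⟨sub_nonneg.mpr ht.1, sub_le_iff_le_add'.mpr ht.2⟩ hz
    rwa [mul_div_cancel₀ ε (by positivity), ← sub_zero (cylPhase k ξ z - _)] at h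
  rw [schrodinger_focusWave]
  refine le_trans ?_ (sum_integral_mul_cos_le_norm (latticeCube m N) 0
    (fun k _ => integrable_focusWeight α N k) fun k _ => hmeas k)
  calc (∫ η, focusMinorant n κ ε η) * (N : ℝ) ^ ((m : ℝ) + n - α)
      = ∑ _k ∈ latticeCube m N,
          (N : ℝ) ^ (-α) * ((N : ℝ) ^ n * ∫ η, focusMinorant n κ ε η) := by
        rw [Finset.sum_const, card_latticeCube, nsmul_eq_mul, sub_eq_add_neg, Real.rpow_add hN,
          Real.rpow_add hN, Real.rpow_natCast, Real.rpow_natCast, Nat.cast_pow]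
        ring
    _ ≤ _ := Finset.sum_le_sum fun k hk =>
        le_integral_focusWeight_mul_cos hk hα hε0.le hε ((hmeas k).sub_const 0) (hphase k hk)

theorem le_mixedNorm {q r : ℝ≥0∞} (hq : q ≠ 0) (hr : r ≠ 0) {f : Cyl m n → ℂ} {ρ τ t₀ c : ℝ}
    (hρ : ρ ∈ Set.Ioc 0 1) (hτ : 0 < τ) (ht₀ : 0 ≤ t₀) (ht₁ : t₀ + τ ≤ 1)
    (hc : ∀ z ∈ cylCube m n ρ, ∀ t ∈ Set.Icc t₀ (t₀ + τ), c ≤ ‖schrodinger t f z‖) :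
    ENNReal.ofReal c * ENNReal.ofReal τ ^ (r⁻¹).toReal *
      ENNReal.ofReal (ρ ^ (m + n)) ^ (q⁻¹).toReal ≤ mixedNorm q r f := by
  obtain ⟨hρ0, hρ1⟩ := hρ
  have hcube : cylMeasure m n (cylCube m n ρ) = ENNReal.ofReal (ρ ^ (m + n)) :=
    cylMeasure_cylCube hρ0.le (by linarith [Real.pi_gt_three])
  have htime : timeMeasure (Set.Icc t₀ (t₀ + τ)) = ENNReal.ofReal τ := by
    rw [timeMeasure_Icc ht₀ ht₁, add_sub_cancel_left]
  rw [← hcube, ← htime]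
  refine mul_measure_rpow_le_eLpNorm (measurableSet_cylCube ρ) ?_ hq fun z hz => ?_
  · rw [hcube]
    exact (ENNReal.ofReal_pos.mpr (pow_pos hρ0 _)).ne'
  · rw [enorm_eq_self]
    refine mul_measure_rpow_le_eLpNorm measurableSet_Icc ?_ hr fun t ht => ?_
    · rw [htime]
      exact (ENNReal.ofReal_pos.mpr hτ).ne'
    · rw [← ofReal_norm]
      exact ENNReal.ofReal_le_ofReal (hc z hz t ht)

theorem coprime_four_mul_add_one (a : ℕ) : a.Coprime (4 * a + 1) := by
  simp

theorem pi_mul_div_four_mul_add_one_mem_Icc {a : ℕ} (ha : 1 ≤ a) :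
    Real.pi * a / (4 * a + 1 : ℕ) ∈ Set.Icc (Real.pi / 5) (4 / 5) := by
  have ha' : (1 : ℝ) ≤ a := Nat.one_le_cast.mpr ha
  push_cast
  constructor
  · rw [div_le_div_iff₀ (by norm_num) (by positivity)]
    nlinarith [Real.pi_pos]
  · rw [div_le_div_iff₀ (by positivity) (by norm_num)]
    nlinarith [Real.pi_lt_d2]

theorem sqrt_mul_one_add_log_le {x ε : ℝ} (hx : 1 ≤ x) (hε : 0 < ε) :
    Real.sqrt (3 * x * (1 + Real.log x)) ≤
      Real.sqrt (3 * (1 + 1 / (2 * ε))) * x ^ (1 / 2 + ε) := by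
  have hx0 : 0 < x := zero_lt_one.trans_le hx
  have hlog : 1 + Real.log x ≤ (1 + 1 / (2 * ε)) * x ^ (2 * ε) := by
    rw [add_mul, one_mul, one_div_mul_eq_div]
    exact add_le_add (Real.one_le_rpow hx (by positivity))
      (Real.log_le_rpow_div hx0.le (by positivity))
  have hpow : (x ^ (1 / 2 + ε)) ^ 2 = x * x ^ (2 * ε) := by
    rw [← Real.rpow_mul_natCast hx0.le, ← Real.rpow_one_add' hx0.le (by positivity)]
    congr 1
    push_cast
    ring
  refine Real.sqrt_le_iff.mpr ⟨by positivity, ?_⟩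
  rw [mul_pow, Real.sq_sqrt (by positivity), hpow]
  calc 3 * x * (1 + Real.log x) ≤ 3 * x * ((1 + 1 / (2 * ε)) * x ^ (2 * ε)) := by gcongr
    _ = 3 * (1 + 1 / (2 * ε)) * (x * x ^ (2 * ε)) := by ring

theorem focusWave_mixedNorm_bound {p q r : ℝ≥0∞} (hq : q ≠ 0) (hr : r ≠ 0) {α : ℝ} {C : ℝ≥0}
    (hC : ∀ f : Cyl m n → ℂ, IsCylSchwartz f → mixedNorm q r f ≤ C * sobolevNorm α p f)
    {a N : ℕ} [NeZero N] (haN : a.Coprime N)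
    (ht₀ : Real.pi * a / N ∈ Set.Icc (Real.pi / 5) (4 / 5)) {c δ : ℝ} (hc : 0 ≤ c) (hδ0 : 0 < δ)
    (hδ : δ ≤ 1 / 8)
    (hlow : ∀ z ∈ cylCube m n (δ / N),
      ∀ t ∈ Set.Icc (Real.pi * a / N) (Real.pi * a / N + δ / N ^ 2),
        c ≤ ‖schrodinger t (focusWave m n α (Real.pi * a / N) N) z‖) :
    c * (δ / (N : ℝ) ^ 2) ^ (r⁻¹).toReal * ((δ / N) ^ (m + n)) ^ (q⁻¹).toReal ≤
      C * (Real.sqrt (3 * N * (1 + Real.log N)) ^ m * 5 ^ n * (((N : ℝ) ^ n) ^ (p⁻¹).toReal *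
        (eLpNorm (fun z : Cyl m n => gaussProfile n z.2) p (cylMeasure m n)).toReal)) := by
  have hN1 : (1 : ℝ) ≤ N := Nat.one_le_cast.mpr NeZero.one_le
  have hN0 : (0 : ℝ) < N := zero_lt_one.trans_le hN1
  have hρ1 : δ / N ≤ 1 := (div_le_self hδ0.le hN1).trans (by linarith)
  have hτ1 : δ / (N : ℝ) ^ 2 ≤ 1 / 8 := (div_le_self hδ0.le (one_le_pow₀ hN1)).trans hδ
  have hlower := le_mixedNorm hq hr ⟨by positivity, hρ1⟩ (by positivity) (by positivity)
    (by linarith [ht₀.2]) hlow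
  have hupper := (hC _ (isCylSchwartz_waveSum _ _)).trans (mul_le_mul_right
    (sobolevNorm_focusWave_le haN ⟨ht₀.1, ht₀.2.trans (by norm_num)⟩ α p) _)
  have hfinite := ENNReal.mul_ne_top (ENNReal.coe_ne_top (r := C)) (ENNReal.mul_ne_top
    (ENNReal.ofReal_ne_top (r := Real.sqrt (3 * N * (1 + Real.log N)) ^ m * 5 ^ n))
    (ENNReal.mul_ne_top (ENNReal.rpow_ne_top_of_nonneg (ENNReal.toReal_nonneg (a := p⁻¹))
      (ENNReal.ofReal_ne_top (r := (N : ℝ) ^ n)))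
      (eLpNorm_comp_snd_ne_top (m := m) (gaussProfile n) p)))
  have hreal := ENNReal.toReal_mono hfinite (hlower.trans hupper)
  simpa only [ENNReal.toReal_mul, ← ENNReal.toReal_rpow, ENNReal.coe_toReal,
    ENNReal.toReal_ofReal hc, ENNReal.toReal_ofReal (div_pos hδ0 (pow_pos hN0 2)).le,
    ENNReal.toReal_ofReal (pow_pos (div_pos hδ0 hN0) (m + n)).le,
    ENNReal.toReal_ofReal (pow_pos hN0 n).le, ENNReal.toReal_ofReal (show
      0 ≤ Real.sqrt (3 * N * (1 + Real.log N)) ^ m * 5 ^ n by positivity)] using hreal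

theorem rpow_mul_div_rpow_mul_div_rpow {x δ : ℝ} (hx : 0 < x) (hδ : 0 ≤ δ) (β i j : ℝ) (d : ℕ) :
    x ^ β * (δ / x ^ 2) ^ i * ((δ / x) ^ d) ^ j =
      δ ^ i * (δ ^ d) ^ j * x ^ (β - 2 * i - d * j) := by
  have hsq : (x ^ 2) ^ i = x ^ (2 * i) := by
    rw [← Real.rpow_natCast_mul hx.le, Nat.cast_ofNat]
  rw [div_pow, Real.div_rpow hδ (by positivity), Real.div_rpow (by positivity) (by positivity),
    hsq, ← Real.rpow_natCast_mul hx.le, Real.rpow_sub hx, Real.rpow_sub hx]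
  ring

theorem sobolev_exponent_le_add {p q r : ℝ≥0∞} (hq : q ≠ 0) (hr : r ≠ 0) {α : ℝ} (hα : 0 ≤ α)
    {C : ℝ≥0}
    (hC : ∀ f : Cyl m n → ℂ, IsCylSchwartz f → mixedNorm q r f ≤ C * sobolevNorm α p f)
    {ε : ℝ} (hε : 0 < ε) :
    (m : ℝ) + n - α - 2 * (r⁻¹).toReal - (m + n : ℕ) * (q⁻¹).toReal ≤
      m * (1 / 2 + ε) + n * (p⁻¹).toReal := by
  obtain ⟨c, hc, δ, hδ0, hδ, hlow⟩ := exists_le_norm_schrodinger_focusWave m n hα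
  set A := Real.sqrt (3 * (1 + 1 / (2 * ε)))
  set E := (eLpNorm (fun z : Cyl m n => gaussProfile n z.2) p (cylMeasure m n)).toReal
  have hu : Tendsto (fun a : ℕ => ((4 * a + 1 : ℕ) : ℝ)) atTop atTop :=
    tendsto_natCast_atTop_atTop.comp
      (tendsto_atTop_mono (fun a => show a ≤ 4 * a + 1 by lia) tendsto_id)
  refine le_of_eventually_mul_rpow_le hu
    (c := c * (δ ^ (r⁻¹).toReal * (δ ^ (m + n)) ^ (q⁻¹).toReal))
    (C := C * (A ^ m * 5 ^ n * E)) (by positivity) ?_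
  filter_upwards [eventually_ge_atTop 1] with a ha
  have hbound := focusWave_mixedNorm_bound hq hr hC (coprime_four_mul_add_one a)
    (pi_mul_div_four_mul_add_one_mem_Icc ha) (by positivity) hδ0 hδ
    (hlow (4 * a + 1) (Real.pi * a / (4 * a + 1 : ℕ)))
  have hN1 : (1 : ℝ) ≤ (4 * a + 1 : ℕ) := Nat.one_le_cast.mpr (Nat.le_add_left 1 _)
  generalize ((4 * a + 1 : ℕ) : ℝ) = x at hN1 hbound
  have hx : 0 < x := zero_lt_one.trans_le hN1
  calc c * (δ ^ (r⁻¹).toReal * (δ ^ (m + n)) ^ (q⁻¹).toReal) *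
        x ^ ((m : ℝ) + n - α - 2 * (r⁻¹).toReal - (m + n : ℕ) * (q⁻¹).toReal)
      = c * x ^ ((m : ℝ) + n - α) * (δ / x ^ 2) ^ (r⁻¹).toReal *
          ((δ / x) ^ (m + n)) ^ (q⁻¹).toReal := by
        rw [mul_assoc c, ← rpow_mul_div_rpow_mul_div_rpow hx hδ0.le]
        ring
    _ ≤ C * (Real.sqrt (3 * x * (1 + Real.log x)) ^ m * 5 ^ n *
          ((x ^ n) ^ (p⁻¹).toReal * E)) := hbound
    _ ≤ C * ((A * x ^ (1 / 2 + ε)) ^ m * 5 ^ n * ((x ^ n) ^ (p⁻¹).toReal * E)) := by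
        gcongr
        exact sqrt_mul_one_add_log_le hN1 hε
    _ = C * (A ^ m * 5 ^ n * E) * x ^ (m * (1 / 2 + ε) + n * (p⁻¹).toReal) := by
        rw [mul_pow, ← Real.rpow_natCast_mul hx.le, Real.rpow_add hx (m * _),
          mul_comm (m : ℝ), Real.rpow_mul_natCast hx.le]
        ring

theorem sobolev_exponent_ge {p q r : ℝ≥0∞} (hq : q ≠ 0) (hr : r ≠ 0) {α : ℝ} (hα : 0 ≤ α)
    {C : ℝ≥0}
    (hC : ∀ f : Cyl m n → ℂ, IsCylSchwartz f → mixedNorm q r f ≤ C * sobolevNorm α p f) :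
    ((m : ℝ) + n) * (1 / 2 - (q⁻¹).toReal) + n * (1 / 2 - (p⁻¹).toReal) - 2 * (r⁻¹).toReal ≤ α := by
  have hlim : (m : ℝ) + n - α - 2 * (r⁻¹).toReal - (m + n : ℕ) * (q⁻¹).toReal ≤
      m * (1 / 2) + n * (p⁻¹).toReal := by
    refine le_of_forall_pos_le_add fun ε hε => ?_
    have hm : m * (ε / (m + 1)) ≤ ε := by
      rw [mul_div_left_comm]
      exact mul_le_of_le_one_right hε.le (div_le_one_of_le₀ (by linarith) (by positivity))
    linarith [sobolev_exponent_le_add hq hr hα hC (show 0 < ε / (m + 1) by positivity)]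
  push_cast at hlim
  linarith

end SobolevExponent

theorem proposition1p3_general (m n : ℕ) :
    (∀ (p q r : ℝ≥0∞) (α : ℝ), p ≠ 0 → q ≠ 0 → r ≠ 0 → 0 ≤ α →
      (∃ C : ℝ≥0, ∀ f : Cyl m n → ℂ, IsCylSchwartz f →
        mixedNorm q r f ≤ C * sobolevNorm α p f) →
      α ≥ ((m : ℝ) + n) * (1 / 2 - (q⁻¹).toReal) + n * (1 / 2 - (p⁻¹).toReal)
            - 2 * (r⁻¹).toReal ∧
      (p = q → q = r →
        α ≥ ((m : ℝ) + 2 * n) * (1 / 2 - (p⁻¹).toReal) - 2 * (p⁻¹).toReal) ∧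
      (p = 2 → q = r →
        α ≥ ((m : ℝ) + n) * (1 / 2 - (q⁻¹).toReal) - 2 * (q⁻¹).toReal)) ∧
    (1 ≤ m → ∀ (σ : Cyl m n → ℝ), IsUnitCubePartition σ →
      ∀ (p q : ℝ≥0∞) (α : ℝ), p ≠ 0 → q ≠ 0 →
      (∃ C : ℝ≥0, ∀ f : Cyl m n → ℂ, IsCylSchwartz f →
        spaceTimeNorm p f ≤ C * modulationNorm σ α p q f) →
      α ≥ max 0 (((m : ℝ) + n) * (1 - (p⁻¹).toReal - (q⁻¹).toReal) - 2 * (p⁻¹).toReal)) := by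
  refine ⟨fun p q r α _ hq hr hα ⟨C, hC⟩ => ?_, fun hm σ hσ p q α hp _ ⟨C, hC⟩ => ?_⟩
  · have hexponent := sobolev_exponent_ge hq hr hα hC
    refine ⟨hexponent, ?_, ?_⟩
    · rintro rfl rfl
      linarith
    · rintro rfl rfl
      rw [ENNReal.toReal_inv 2, ENNReal.toReal_ofNat] at hexponent
      linarith
  · have hα := modulation_exponent_nonneg hm hσ hp hC
    exact max_le hα (modulation_exponent_ge hσ hp hα hC)

theorem proposition1p3 (m n : ℕ) (hm : 1 ≤ m) (hn : 1 ≤ n) :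
    (∀ (p q r : ℝ≥0∞) (α : ℝ), 1 ≤ p → 1 ≤ q → 1 ≤ r → 0 ≤ α →
      (∃ C : ℝ≥0, ∀ f : Cyl m n → ℂ, IsCylSchwartz f →
        mixedNorm q r f ≤ C * sobolevNorm α p f) →
      α ≥ ((m : ℝ) + n) * (1 / 2 - (q⁻¹).toReal) + n * (1 / 2 - (p⁻¹).toReal)
            - 2 * (r⁻¹).toReal ∧
      (p = q → q = r →
        α ≥ ((m : ℝ) + 2 * n) * (1 / 2 - (p⁻¹).toReal) - 2 * (p⁻¹).toReal) ∧
      (p = 2 → q = r →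
        α ≥ ((m : ℝ) + n) * (1 / 2 - (q⁻¹).toReal) - 2 * (q⁻¹).toReal)) ∧
    (∀ (σ : Cyl m n → ℝ), IsUnitCubePartition σ →
      ∀ (p q : ℝ≥0∞) (α : ℝ), 1 ≤ p → 1 ≤ q →
      (∃ C : ℝ≥0, ∀ f : Cyl m n → ℂ, IsCylSchwartz f →
        spaceTimeNorm p f ≤ C * modulationNorm σ α p q f) →
      α ≥ max 0 (((m : ℝ) + n) * (1 - (p⁻¹).toReal - (q⁻¹).toReal) - 2 * (p⁻¹).toReal)) := by
  obtain ⟨hsobolev, hmodulation⟩ := proposition1p3_general m n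
  refine ⟨fun p q r α hp hq hr => hsobolev p q r α ?_ ?_ ?_,
    fun σ hσ p q α hp hq => hmodulation hm σ hσ p q α ?_ ?_⟩ <;>
  exact (zero_lt_one.trans_le ‹_›).ne'
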